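/- (Triangle condition.) Let $G = T_1 \times T_2 \times \cdots \times T_N$ be the Cartesian product of finitely many trees $T_i$, each of which is regular with some degree $k_i \geq 3$, and let $0$ be an arbitrary root vertex of $G$. For $p \in [0,1]$ let $\tau_p(x,y)$ be the probability that the vertices $x$ and $y$ are connected by open edges in Bernoulli bond percolation on $G$ with retention probability $p$, and let $p_c \in [0,1]$ be the critical probability of $G$, i.e. the infimum of those $p\in[0,1]$ for which an infinite open cluster exists with positive probability (with $p_c = 1$ if there is no such $p$). Then \[ \nabla_{p_c} := \sum_{x,y} \tau_{p_c}(0,x)\,\tau_{p_c}(x,y)\,\tau_{p_c}(y,0) \;\leq\; \prod_{i=1}^N \frac{(k_i-1)^3}{\left(\sqrt{k_i-1}-1\right)^6} \;<\; \infty , \] where the sum runs over all pairs of vertices $x,y$ of $G$. -/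

import Mathlib

open scoped ENNReal

namespace Percolation

/-- The Cartesian product of a family of graphs: two vertices are adjacent iff they are adjacent in
one coordinate and agree in all the others. -/
def cartesianProduct {ι : Type*} {V : ι → Type*} (T : ∀ i, SimpleGraph (V i)) :
    SimpleGraph (∀ i, V i) where
  Adj x y := ∃ i, (T i).Adj (x i) (y i) ∧ ∀ j, j ≠ i → x j = y j
  symm.symm := fun _ _ ⟨i, h, h'⟩ => ⟨i, h.symm, fun j hj => (h' j hj).symm⟩
  loopless.irrefl := fun _ ⟨i, h, _⟩ => (T i).irrefl h

variable {V : Type*} (G : SimpleGraph V)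

/-- A percolation configuration declares every edge of `G` open (`true`) or closed (`false`). -/
abbrev Configuration : Type _ := G.edgeSet → Bool

/-- The random subgraph of `G` that consists of all vertices and of the open edges. -/
def openSubgraph (ω : Configuration G) : SimpleGraph V where
  Adj x y := ∃ e : G.edgeSet, (e : Sym2 V) = s(x, y) ∧ ω e = true
  symm.symm := fun _ _ ⟨e, he, h⟩ => ⟨e, he.trans Sym2.eq_swap, h⟩
  loopless.irrefl := fun x ⟨e, he, _⟩ => by
    have h := e.2
    rw [he] at h
    exact G.irrefl h

/-- Bernoulli bond percolation with retention probability `p`: the edges are open independently of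
each other, each with probability `p`. -/
noncomputable def bondMeasure (p : unitInterval) : MeasureTheory.Measure (Configuration G) :=
  MeasureTheory.Measure.infinitePi fun _ => ProbabilityTheory.bernoulliMeasure true false p

instance (p : unitInterval) : MeasureTheory.IsProbabilityMeasure (bondMeasure G p) := by
  unfold bondMeasure
  infer_instance

/-- The connection probability `τ_p(x, y)`: the probability that `x` and `y` are joined by a path
of open edges. -/
noncomputable def tau (p : unitInterval) (x y : V) : ℝ≥0∞ :=
  bondMeasure G p {ω | (openSubgraph G ω).Reachable x y}

/-- The event that some cluster (connected component of the open subgraph) is infinite. -/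
def existsInfiniteCluster : Set (Configuration G) :=
  {ω | ∃ C : (openSubgraph G ω).ConnectedComponent, C.supp.Infinite}

/-- The critical probability `p_c(G)`: the infimum, in `[0, 1]`, of the retention probabilities at
which an infinite cluster exists with positive probability (equivalently, by the zero-one law, with
probability one); it is `1` if there is no such retention probability. -/
noncomputable def criticalProbability : unitInterval :=
  sInf {p : unitInterval | 0 < bondMeasure G p (existsInfiniteCluster G)}

/-- The triangle diagram `∇_p = ∑_{x,y} τ_p(o, x) τ_p(x, y) τ_p(y, o)` with root `o`, as an extended
nonnegative real. -/
noncomputable def triangle (p : unitInterval) (o : V) : ℝ≥0∞ :=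
  ∑' x : V, ∑' y : V, tau G p o x * tau G p x y * tau G p y o

end Percolation

/-! The core is the bound τ(o,x) ≤ ∏ (k_i-1)^(-d_i) at p_c, where d_i is the distance of o and x in
the i-th tree (`tau_criticalProbability_le`).

Below p_c, at parameters arbitrarily close to it, the Duminil-Copin–Tassion argument yields a finite
set with boundary flux less than one (`exists_boundaryFlux_lt_one`). Iterating a first-exit
inequality, with transitivity, then makes the susceptibility finite (`exists_sum_tau_le`).
Automorphisms of the factors make τ a function of the distance vector alone, and Harris makes it
supermultiplicative along prolonged geodesics: t = τ(o,x) gives τ ≥ t^m at all vertices with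
distance vector m·d. There are at least A^m of them, A = ∏ (k_i-1)^(d_i), so (At)^m is bounded in m
and At ≤ 1 (`tau_le_prod_inv_pow_dist`). The bound does not depend on p and survives p ↑ p_c,
because τ is a supremum of polynomials in p.

For the triangle, let m be the coordinatewise median of o, x, y. The three pairwise distances add up
to twice the distances to m, so the summand is at most K(o,m)K(m,x)K(m,y) with K = ∏ (k_i-1)^(-2
dist). Summing over all m, x, y gives the cube of a product of one-tree sums
(`triangle_le_of_tau_le`), each bounded by (k_i-1)/(√(k_i-1)-1)^2 (`tsum_inv_sq_pow_dist_le`). -/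

namespace Percolation

open MeasureTheory ProbabilityTheory Set

/-! ### Independent coins: cylinder events, polynomial probabilities, the Harris inequality, Russo's
formula. -/

section Bernoulli

variable {E : Type*}

/-- The law of a family of independent `p`-coins indexed by `E`. -/
noncomputable def coinMeasure (E : Type*) (p : unitInterval) : Measure (E → Bool) :=
  Measure.infinitePi fun _ => bernoulliMeasure true false p

instance (p : unitInterval) : IsProbabilityMeasure (coinMeasure E p) := by
  unfold coinMeasure
  infer_instance

/-- An event is determined by the coordinates in `F`. -/
def DeterminedBy (A : Set (E → Bool)) (F : Set E) : Prop :=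
  ∀ ω ω', (∀ e ∈ F, ω e = ω' e) → ω ∈ A → ω' ∈ A

theorem DeterminedBy.mono {A : Set (E → Bool)} {F F' : Set E} (h : DeterminedBy A F)
    (hF : F ⊆ F') : DeterminedBy A F' :=
  fun ω ω' h' hω => h ω ω' (fun e he => h' e (hF he)) hω

theorem DeterminedBy.inter {A B : Set (E → Bool)} {F : Set E} (hA : DeterminedBy A F)
    (hB : DeterminedBy B F) : DeterminedBy (A ∩ B) F :=
  fun ω ω' h hω => ⟨hA ω ω' h hω.1, hB ω ω' h hω.2⟩

/-- This reduces measurability and independence to the finite space `F → Bool`, in which every set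
is measurable. -/
theorem DeterminedBy.eq_preimage {A : Set (E → Bool)} {F : Finset E}
    (h : DeterminedBy A (F : Set E)) :
    A = (fun (ω : E → Bool) (e : F) => ω e) ⁻¹' ((fun (ω : E → Bool) (e : F) => ω e) '' A) := by
  ext ω
  constructor
  · exact fun hω => ⟨ω, hω, rfl⟩
  · rintro ⟨ω', hω', he⟩
    exact h ω' ω (fun e he' => congrFun he ⟨e, he'⟩) hω'

theorem DeterminedBy.measurableSet {A : Set (E → Bool)} {F : Finset E}
    (h : DeterminedBy A (F : Set E)) : MeasurableSet A := by
  rw [h.eq_preimage]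
  have : Measurable (fun (ω : E → Bool) (e : F) => ω e) := by fun_prop
  exact this (Set.toFinite _).measurableSet

theorem coinMeasure_inter {A B : Set (E → Bool)} {F F' : Finset E} (p : unitInterval)
    (hA : DeterminedBy A (F : Set E)) (hB : DeterminedBy B (F' : Set E)) (hF : Disjoint F F') :
    coinMeasure E p (A ∩ B) = coinMeasure E p A * coinMeasure E p B := by
  have hi : iIndepFun (fun (e : E) (ω : E → Bool) => ω e) (coinMeasure E p) :=
    iIndepFun_infinitePi (P := fun _ : E => bernoulliMeasure true false p)
      (X := fun _ b => b) (fun _ => measurable_id)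
  have h2 := hi.indepFun_finset F F' hF (fun e => measurable_pi_apply e)
  rw [hA.eq_preimage, hB.eq_preimage]
  exact h2.measure_inter_preimage_eq_mul _ _ (Set.toFinite _).measurableSet
    (Set.toFinite _).measurableSet

theorem coinMeasure_apply_true (p : unitInterval) (e : E) :
    coinMeasure E p {ω | ω e = true} = ENNReal.ofReal p := by
  have h := (measurePreserving_eval_infinitePi
    (fun _ : E => bernoulliMeasure true false p) e).measure_preimage
    (s := {true}) (MeasurableSet.nullMeasurableSet (measurableSet_singleton _))
  have h2 : bernoulliMeasure true false p {true} = ENNReal.ofReal p := by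
    rw [bernoulliMeasure_apply p (measurableSet_singleton _)]
    simp
    exact (ENNReal.ofReal_coe_nnreal (p := unitInterval.toNNReal p)).symm
  rw [← h2, ← h]
  rfl

/-- The configuration whose open coordinates are those of `s`. -/
noncomputable def openOn (F : Finset E) (s : Finset F) (e : E) : Bool :=
  open Classical in decide (∃ h : e ∈ F, (⟨e, h⟩ : F) ∈ s)

/-- The probability of an event determined by `F`, as a polynomial in the parameter. -/
noncomputable def coinPoly (F : Finset E) (A : Set (E → Bool)) (t : ℝ) : ℝ :=
  open Classical in
  ∑ s : Finset F, t ^ s.card * (1 - t) ^ (F.card - s.card) * (if openOn F s ∈ A then 1 else 0)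

/-- Split according to the set `s` of open coordinates in `F`; `openOn F s` represents its class.
Polynomiality supplies both the derivative in Russo's formula and the continuity used in passing to
the critical point. -/
theorem coinMeasure_real_eq_coinPoly {A : Set (E → Bool)} {F : Finset E} (p : unitInterval)
    (hA : DeterminedBy A (F : Set E)) : (coinMeasure E p).real A = coinPoly F A p := by
  classical
  set f : (E → Bool) → Finset F := fun ω => Finset.univ.filter (fun e => ω e = true) with hf
  have hmem : ∀ ω s, f ω = s ↔ ∀ e : F, ω e = decide (e ∈ s) := by
    intro ω s
    constructor
    · rintro rfl e
      simp [hf]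
    · intro h
      ext e
      simp [hf, h]
  have hpre : A = f ⁻¹' (Finset.univ.filter (fun s => openOn F s ∈ A) : Finset (Finset F)) := by
    ext ω
    have key : ∀ e ∈ (F : Set E), ω e = openOn F (f ω) e := by
      intro e he
      have he' : e ∈ F := he
      have := (hmem ω (f ω)).1 rfl ⟨e, he⟩
      simpa [openOn, he'] using this
    simp only [Finset.coe_filter, Finset.mem_univ, true_and, mem_preimage, mem_ofPred_eq]
    exact ⟨hA _ _ key, hA _ _ (fun e he => (key e he).symm)⟩
  have hcyl : ∀ s, f ⁻¹' {s} = Set.pi (F : Set E) (fun e => {openOn F s e}) := by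
    intro s
    ext ω
    simp only [mem_preimage, mem_singleton_iff, hmem, Set.mem_pi, Finset.mem_coe]
    constructor
    · intro h e he
      simpa [openOn, he] using h ⟨e, he⟩
    · intro h e
      simpa [openOn] using h e e.2
  have hdet : ∀ s, DeterminedBy (f ⁻¹' {s}) (F : Set E) := by
    intro s ω ω' h hω
    rw [hcyl] at hω ⊢
    intro e he
    rw [← h e he]
    exact hω e he
  have hprob : ∀ s, (coinMeasure E p).real (f ⁻¹' {s}) =
      (p : ℝ) ^ s.card * (1 - p) ^ (F.card - s.card) := by
    intro s
    rw [hcyl, measureReal_def, coinMeasure,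
      Measure.infinitePi_pi _ (fun e _ => measurableSet_singleton _), ENNReal.toReal_prod]
    have : ∀ e, (bernoulliMeasure true false p {openOn F s e}).toReal =
        if openOn F s e = true then (p : ℝ) else 1 - p := by
      intro e
      rw [← measureReal_def, bernoulliMeasure_real_apply p (measurableSet_singleton _)]
      cases openOn F s e <;> simp
    simp_rw [this]
    rw [Finset.prod_ite, Finset.prod_const, Finset.prod_const]
    have h1 : (F.filter (fun e => openOn F s e = true)).card = s.card := by
      have : F.filter (fun e => openOn F s e = true) = s.map (Function.Embedding.subtype _) := by
        ext e
        simp [openOn]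
      rw [this, Finset.card_map]
    have h2 := F.card_filter_add_card_filter_not (fun e => openOn F s e = true)
    rw [h1] at h2 ⊢
    congr 2
    omega
  conv_lhs => rw [hpre]
  rw [measureReal_def, ← sum_measure_preimage_singleton _ (fun s _ => (hdet s).measurableSet),
    ENNReal.toReal_sum (fun _ _ => measure_ne_top _ _), Finset.sum_filter, coinPoly]
  refine Finset.sum_congr rfl fun s _ => ?_
  rw [← measureReal_def, hprob]
  split_ifs <;> simp

theorem continuous_coinPoly (F : Finset E) (A : Set (E → Bool)) : Continuous (coinPoly F A) := by
  unfold coinPoly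
  fun_prop

/-- An event is increasing if it is stable under opening coordinates. -/
def Increasing (A : Set (E → Bool)) : Prop :=
  ∀ ω ω', (∀ e, ω e = true → ω' e = true) → ω ∈ A → ω' ∈ A

/-- The **Harris inequality** for increasing events that depend on finitely many coordinates. -/
theorem coinMeasure_mul_le_inter {A B : Set (E → Bool)} {F : Finset E} (p : unitInterval)
    (hA : DeterminedBy A (F : Set E)) (hB : DeterminedBy B (F : Set E))
    (hA' : Increasing A) (hB' : Increasing B) :
    coinMeasure E p A * coinMeasure E p B ≤ coinMeasure E p (A ∩ B) := by
  classical
  have hmono : ∀ {A : Set (E → Bool)}, Increasing A →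
      Monotone (fun s : Finset F => if openOn F s ∈ A then (1 : ℝ) else 0) := by
    intro A hA s t hst
    dsimp only
    split_ifs with h1 h2
    · exact le_rfl
    · refine absurd (hA _ _ (fun e he => ?_) h1) h2
      simp only [openOn, decide_eq_true_eq] at he ⊢
      exact ⟨he.1, hst he.2⟩
    · exact zero_le_one
    · exact le_rfl
  have hp0 : 0 ≤ (p : ℝ) := p.2.1
  have hp1 : 0 ≤ 1 - (p : ℝ) := sub_nonneg.2 p.2.2
  have h := fkg (μ := fun s : Finset F => (p : ℝ) ^ s.card * (1 - p) ^ (F.card - s.card))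
    (f := fun s : Finset F => if openOn F s ∈ A then (1 : ℝ) else 0)
    (g := fun s : Finset F => if openOn F s ∈ B then (1 : ℝ) else 0)
    (fun s => by positivity) (fun s => by dsimp; split_ifs <;> simp)
    (fun s => by dsimp; split_ifs <;> simp) (hmono hA') (hmono hB') (by
      intro s t
      have h1 := Finset.card_union_add_card_inter s t
      have hs := s.card_le_univ
      have ht := t.card_le_univ
      have hu := (s ∪ t).card_le_univ
      have hn := (s ∩ t).card_le_univ
      simp only [Fintype.card_coe] at hs ht hu hn
      simp only [Finset.inf_eq_inter, Finset.sup_eq_union]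
      -- The lattice condition of FKG is an equality for product weights, as |s ∪ t| + |s ∩ t| = |s|
      -- + |t|.
      apply le_of_eq
      rw [mul_mul_mul_comm, ← pow_add, ← pow_add, mul_mul_mul_comm, ← pow_add, ← pow_add]
      congr 2 <;> omega)
  have hone := coinMeasure_real_eq_coinPoly (A := (Set.univ : Set (E → Bool))) (F := F) p
    (fun _ _ _ _ => trivial)
  rw [probReal_univ] at hone
  have h3 : (coinMeasure E p).real A * (coinMeasure E p).real B ≤
      (coinMeasure E p).real (A ∩ B) := by
    rw [coinMeasure_real_eq_coinPoly p hA, coinMeasure_real_eq_coinPoly p hB,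
      coinMeasure_real_eq_coinPoly p (hA.inter hB)]
    simp only [coinPoly, Set.mem_univ, if_true, mul_one] at hone
    rw [← hone, one_mul] at h
    refine h.trans (le_of_eq ?_)
    refine Finset.sum_congr rfl fun s _ => ?_
    by_cases h1 : openOn F s ∈ A <;> by_cases h2 : openOn F s ∈ B <;> simp [h1, h2]
  rw [← ENNReal.toReal_le_toReal (ENNReal.mul_ne_top (measure_ne_top _ _) (measure_ne_top _ _))
    (measure_ne_top _ _), ENNReal.toReal_mul]
  exact h3

/-- Russo's formula, in covariance form. -/
theorem hasDerivAt_coinPoly (F : Finset E) (A : Set (E → Bool)) (t : ℝ) :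
    ∃ D, HasDerivAt (coinPoly F A) D t ∧
      t * (1 - t) * D = ∑ e ∈ F, (coinPoly F (A ∩ {ω | ω e = true}) t - t * coinPoly F A t) := by
  classical
  -- Multiplying by t(1-t) clears the denominators of the logarithmic derivative |s|/t -
  -- (|F|-|s|)/(1-t), so the endpoints need no separate case.
  have hterm : ∀ s : Finset F, ∃ d, HasDerivAt
      (fun t : ℝ => t ^ s.card * (1 - t) ^ (F.card - s.card) *
        (if openOn F s ∈ A then (1 : ℝ) else 0)) d t ∧
      t * (1 - t) * d = (s.card - t * F.card) * (t ^ s.card * (1 - t) ^ (F.card - s.card) *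
        (if openOn F s ∈ A then (1 : ℝ) else 0)) := by
    intro s
    have hs : s.card ≤ F.card := by simpa using s.card_le_univ
    obtain ⟨b, hb⟩ := Nat.exists_eq_add_of_le hs
    rw [hb, Nat.add_sub_cancel_left]
    refine ⟨_, ((hasDerivAt_pow s.card t).mul
      (((hasDerivAt_id t).const_sub 1).pow b)).mul_const _, ?_⟩
    generalize (if openOn F s ∈ A then (1 : ℝ) else 0) = c
    push_cast
    have e1 : ∀ (x : ℝ) (a : ℕ), x * (a * x ^ (a - 1)) = a * x ^ a := by
      intro x a
      cases a with
      | zero => simp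
      | succ a => simp [pow_succ]; ring
    have h1 := e1 t s.card
    have h2 := e1 (1 - t) b
    simp only [id]
    simp only [Pi.pow_apply]
    linear_combination (1 - t) * (1 - t) ^ b * c * h1 - t * t ^ s.card * c * h2
  choose d hd hd' using hterm
  refine ⟨∑ s, d s, ?_, ?_⟩
  · unfold coinPoly
    exact HasDerivAt.fun_sum fun s _ => hd s
  · rw [Finset.mul_sum, Finset.sum_congr rfl (fun s _ => hd' s), Finset.sum_sub_distrib]
    simp only [coinPoly, sub_mul, Finset.sum_sub_distrib, Finset.sum_const, nsmul_eq_mul]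
    congr 1
    · rw [Finset.sum_comm]
      refine Finset.sum_congr rfl fun s _ => ?_
      have : ∀ e ∈ F, (if openOn F s ∈ A ∩ {ω | ω e = true} then (1 : ℝ) else 0) =
          (if openOn F s ∈ A then 1 else 0) * (if openOn F s e = true then 1 else 0) := by
        intro e _
        by_cases h1 : openOn F s ∈ A <;> by_cases h2 : openOn F s e = true <;> simp [h1, h2]
      rw [← Finset.mul_sum, (Finset.sum_congr rfl fun e he => by convert this e he :
        _ = ∑ e ∈ F, (if openOn F s ∈ A then (1 : ℝ) else 0) *
          (if openOn F s e = true then 1 else 0)), ← Finset.mul_sum]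
      -- Counting the open coordinates turns the factor |s| into the sum over `e` of the indicators
      -- of {e open}.
      have h1 : (F.filter (fun e => openOn F s e = true)).card = s.card := by
        have : F.filter (fun e => openOn F s e = true) = s.map (Function.Embedding.subtype _) := by
          ext e
          simp [openOn]
        rw [this, Finset.card_map]
      rw [Finset.sum_ite]
      simp [h1]
      ring_nf
    · rw [← Finset.mul_sum]
      ring

end Bernoulli

/-! ### Open paths inside a set of vertices, and exhaustion by finite regions. -/

section Connectivity

variable {V : Type*} (G : SimpleGraph V)

theorem bondMeasure_eq_coinMeasure (p : unitInterval) :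
    bondMeasure G p = coinMeasure G.edgeSet p := rfl

/-- The graph formed by the open edges with both endpoints in `S`. -/
def openWithin (ω : Configuration G) (S : Set V) : SimpleGraph V where
  Adj x y := (openSubgraph G ω).Adj x y ∧ x ∈ S ∧ y ∈ S
  symm.symm := fun _ _ h => ⟨h.1.symm, h.2.2, h.2.1⟩
  loopless.irrefl := fun _ h => (openSubgraph G ω).irrefl h.1

/-- The event that `x` and `y` are joined by an open path inside `S`. -/
def connWithin (S : Set V) (x y : V) : Set (Configuration G) :=
  {ω | (openWithin G ω S).Reachable x y}

/-- The edges with both endpoints in `S`. -/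
def edgesWithin (S : Set V) : Set G.edgeSet := {e | ∀ v ∈ (e : Sym2 V), v ∈ S}

variable {G}

theorem openSubgraph_adj_iff {ω : Configuration G} {x y : V} :
    (openSubgraph G ω).Adj x y ↔ ∃ h : G.Adj x y, ω ⟨s(x, y), h⟩ = true := by
  constructor
  · rintro ⟨⟨e, he⟩, rfl, h⟩
    exact ⟨he, h⟩
  · rintro ⟨h, h'⟩
    exact ⟨_, rfl, h'⟩

theorem openSubgraph_adj_congr {ω ω' : Configuration G} {x y : V}
    (h : ∀ h : G.Adj x y, ω ⟨s(x, y), h⟩ = ω' ⟨s(x, y), h⟩)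
    (ha : (openSubgraph G ω).Adj x y) : (openSubgraph G ω').Adj x y := by
  rw [openSubgraph_adj_iff] at ha ⊢
  obtain ⟨h1, h2⟩ := ha
  exact ⟨h1, (h h1).symm.trans h2⟩

theorem mem_edgesWithin {S : Set V} {x y : V} (h : G.Adj x y) :
    (⟨s(x, y), h⟩ : G.edgeSet) ∈ edgesWithin G S ↔ x ∈ S ∧ y ∈ S := by
  simp [edgesWithin]

theorem finite_edgesWithin {S : Set V} (hS : S.Finite) : (edgesWithin G S).Finite := by
  refine Set.Finite.of_finite_image
    ((hS.prod hS).image (fun q : V × V => s(q.1, q.2)) |>.subset ?_) Subtype.val_injective.injOn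
  rintro _ ⟨⟨e, he⟩, h, rfl⟩
  induction e with
  | h x y =>
    obtain ⟨hx, hy⟩ := (mem_edgesWithin he).1 h
    exact ⟨(x, y), ⟨hx, hy⟩, rfl⟩

theorem openWithin_mono {ω ω' : Configuration G} {S S' : Set V} (hS : S ⊆ S')
    (h : ∀ e ∈ edgesWithin G S, ω e = true → ω' e = true) :
    openWithin G ω S ≤ openWithin G ω' S' := by
  rintro x y ⟨h1, hx, hy⟩
  obtain ⟨ha, ho⟩ := openSubgraph_adj_iff.1 h1
  exact ⟨openSubgraph_adj_iff.2 ⟨ha, h _ ((mem_edgesWithin ha).2 ⟨hx, hy⟩) ho⟩, hS hx, hS hy⟩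

theorem connWithin_mono {S S' : Set V} (hS : S ⊆ S') (x y : V) :
    connWithin G S x y ⊆ connWithin G S' x y :=
  fun _ h => h.mono (openWithin_mono hS fun _ _ h => h)

theorem increasing_connWithin (S : Set V) (x y : V) : Increasing (connWithin G S x y) :=
  fun _ _ h hω => SimpleGraph.Reachable.mono (openWithin_mono subset_rfl fun e _ => h e) hω

theorem determinedBy_connWithin (S : Set V) (x y : V) :
    DeterminedBy (connWithin G S x y) (edgesWithin G S) :=
  fun _ _ h hω => SimpleGraph.Reachable.mono
    (openWithin_mono subset_rfl fun e he h' => (h e he).symm.trans h') hω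

theorem openWithin_univ (ω : Configuration G) : openWithin G ω univ = openSubgraph G ω := by
  ext x y
  simp [openWithin]

theorem connWithin_univ (x y : V) :
    connWithin G univ x y = {ω | (openSubgraph G ω).Reachable x y} := by
  simp [connWithin, openWithin_univ]

theorem tau_eq_connWithin_univ (p : unitInterval) (x y : V) :
    tau G p x y = bondMeasure G p (connWithin G univ x y) := by
  rw [connWithin_univ, tau]

/-- The finite set of edges with both endpoints in a finite set of vertices. -/
noncomputable def edgeFinsetWithin (S : Finset V) : Finset G.edgeSet :=
  (finite_edgesWithin (G := G) S.finite_toSet).toFinset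

theorem coe_edgeFinsetWithin (S : Finset V) :
    (edgeFinsetWithin (G := G) S : Set G.edgeSet) = edgesWithin G (S : Set V) := by
  simp [edgeFinsetWithin]

theorem determinedBy_connWithin_finset (S : Finset V) (x y : V) :
    DeterminedBy (connWithin G (S : Set V) x y) (edgeFinsetWithin (G := G) S : Set G.edgeSet) := by
  rw [coe_edgeFinsetWithin]
  exact determinedBy_connWithin _ x y

/-- Membership of the endpoint of an open path inside `S`. -/
theorem mem_of_reachable_openWithin {ω : Configuration G} {S : Set V} {x y : V}
    (h : (openWithin G ω S).Reachable x y) (hx : x ∈ S) : y ∈ S := by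
  rw [SimpleGraph.reachable_iff_reflTransGen] at h
  induction h with
  | refl => exact hx
  | tail _ h _ => exact h.2.2

/-- An open path from `u` to a point outside `K` makes a last exit from `K`. -/
theorem exists_last_exit {ω : Configuration G} {S K : Set V} {u v : V}
    (h : (openWithin G ω S).Reachable u v) (hu : u ∈ K) (hv : v ∉ K) :
    ∃ x ∈ K, ∃ y ∉ K, (openWithin G ω S).Adj x y ∧ (openWithin G ω (S \ K)).Reachable y v := by
  rw [SimpleGraph.reachable_iff_reflTransGen] at h
  -- Strengthened for an induction that prepends edges: either a last exit has been found, or the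
  -- path has so far avoided `K`.
  have key : (∃ x ∈ K, ∃ y ∉ K, (openWithin G ω S).Adj x y ∧
      (openWithin G ω (S \ K)).Reachable y v) ∨
      (u ∉ K ∧ (openWithin G ω (S \ K)).Reachable u v) := by
    clear hu
    induction h using Relation.ReflTransGen.head_induction_on with
    | refl => exact Or.inr ⟨hv, SimpleGraph.Reachable.refl _⟩
    | head hab hbv ih =>
      rename_i a b
      rcases ih with ih | ⟨hb, ih⟩
      · exact Or.inl ih
      · by_cases ha : a ∈ K
        · exact Or.inl ⟨a, ha, b, hb, hab, ih⟩
        · refine Or.inr ⟨ha, SimpleGraph.Reachable.trans (SimpleGraph.Adj.reachable ?_) ih⟩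
          exact ⟨hab.1, ⟨hab.2.1, ha⟩, ⟨hab.2.2, hb⟩⟩
  exact key.resolve_right fun h => h.1 hu

/-- An open path is contained in a finite set of vertices. -/
theorem exists_finset_connWithin {ω : Configuration G} {x y : V}
    (h : (openSubgraph G ω).Reachable x y) :
    ∃ S : Finset V, ω ∈ connWithin G (S : Set V) x y := by
  classical
  rw [SimpleGraph.reachable_iff_reflTransGen] at h
  induction h with
  | refl => exact ⟨∅, SimpleGraph.Reachable.refl _⟩
  | @tail a b _ hab ih =>
    obtain ⟨S, hS⟩ := ih
    refine ⟨insert a (insert b S), SimpleGraph.Reachable.trans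
      (connWithin_mono (by intro z hz; simp_all) _ _ hS) (SimpleGraph.Adj.reachable ?_)⟩
    exact ⟨hab, by simp, by simp⟩

/-- `τ` is the supremum of the connection probabilities in an exhaustion by finite sets. -/
theorem tau_eq_iSup {Λ : ℕ → Finset V} (hmono : Monotone Λ) (hex : ∀ v, ∃ n, v ∈ Λ n)
    (p : unitInterval) (x y : V) :
    tau G p x y = ⨆ n, bondMeasure G p (connWithin G (Λ n : Set V) x y) := by
  have hm : Monotone fun n => connWithin G (Λ n : Set V) x y :=
    fun m n hmn => connWithin_mono (Finset.coe_subset.2 (hmono hmn)) x y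
  rw [← hm.measure_iUnion, tau]
  congr 1
  ext ω
  simp only [mem_iUnion]
  constructor
  · intro h
    obtain ⟨S, hS⟩ := exists_finset_connWithin h
    choose f hf using hex
    refine ⟨S.sup f, connWithin_mono ?_ x y hS⟩
    intro v hv
    exact hmono (Finset.le_sup (f := f) hv) (hf v)
  · rintro ⟨n, hn⟩
    have := connWithin_mono (subset_univ _) x y hn
    rwa [connWithin_univ] at this

/-! ### Boundary flux, cluster exploration and finiteness of the susceptibility. -/

variable (G) in
/-- The Duminil-Copin–Tassion functional: the expected number of open boundary edges of `S` whose
inner endpoint is connected to `o` inside `S`. -/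
noncomputable def boundaryFlux (p : unitInterval) (S : Finset V) (o : V) : ℝ≥0∞ :=
  open Classical in
  ∑ x ∈ S, ∑' y : V, if G.Adj x y ∧ y ∉ S then
    ENNReal.ofReal p * bondMeasure G p (connWithin G (S : Set V) o x) else 0

variable (G) in
/-- The cluster of `u` in the open subgraph inside `S`. -/
def clusterWithin (ω : Configuration G) (S : Set V) (u : V) : Set V :=
  {x | (openWithin G ω S).Reachable u x}

/-- Exploring the cluster from `u` reads only edges that touch it. Hence its law is independent of
all edges that avoid `C`. -/
theorem determinedBy_clusterWithin (S C : Set V) (u : V) :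
    DeterminedBy {ω : Configuration G | clusterWithin G ω S u = C}
      {e | e ∈ edgesWithin G S ∧ ∃ v ∈ (e : Sym2 V), v ∈ C} := by
  intro ω ω' h hω
  have hω : clusterWithin G ω S u = C := hω
  show clusterWithin G ω' S u = C
  have hadj : ∀ {a b}, a ∈ C → (openWithin G ω S).Adj a b → (openWithin G ω' S).Adj a b := by
    rintro a b ha ⟨h1, h2, h3⟩
    exact ⟨openSubgraph_adj_congr (fun hab => h _ ⟨(mem_edgesWithin hab).2 ⟨h2, h3⟩, a, by simp, ha⟩)
      h1, h2, h3⟩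
  have hadj' : ∀ {a b}, a ∈ C → (openWithin G ω' S).Adj a b → (openWithin G ω S).Adj a b := by
    rintro a b ha ⟨h1, h2, h3⟩
    exact ⟨openSubgraph_adj_congr
      (fun hab => (h _ ⟨(mem_edgesWithin hab).2 ⟨h2, h3⟩, a, by simp, ha⟩).symm) h1, h2, h3⟩
  apply Subset.antisymm
  · intro x hx
    change (openWithin G ω' S).Reachable u x at hx
    rw [SimpleGraph.reachable_iff_reflTransGen] at hx
    induction hx with
    | refl =>
      rw [← hω]
      exact SimpleGraph.Reachable.refl _
    | tail _ hab ih =>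
      have := hadj' ih hab
      rw [← hω] at ih ⊢
      exact SimpleGraph.Reachable.trans ih this.reachable
  · intro x hx
    rw [← hω] at hx
    change (openWithin G ω S).Reachable u x at hx
    rw [SimpleGraph.reachable_iff_reflTransGen] at hx
    show (openWithin G ω' S).Reachable u x
    induction hx with
    | refl => exact SimpleGraph.Reachable.refl _
    | tail hua hab ih =>
      refine ih.trans (hadj ?_ hab).reachable
      rw [← hω]
      exact (SimpleGraph.reachable_iff_reflTransGen _ _).2 hua

theorem determinedBy_edge {x y : V} (h : G.Adj x y) :
    DeterminedBy {ω : Configuration G | ω ⟨s(x, y), h⟩ = true} {⟨s(x, y), h⟩} :=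
  fun _ _ h' hω => (h' _ rfl).symm.trans hω

theorem measure_inter_of_disjoint {A B : Set (Configuration G)} {F F' : Set G.edgeSet}
    (p : unitInterval) (hA : DeterminedBy A F) (hB : DeterminedBy B F') (hF : F.Finite)
    (hF' : F'.Finite) (hd : Disjoint F F') :
    bondMeasure G p (A ∩ B) = bondMeasure G p A * bondMeasure G p B := by
  rw [bondMeasure_eq_coinMeasure]
  refine coinMeasure_inter (F := hF.toFinset) (F' := hF'.toFinset) p (by simpa) (by simpa) ?_
  simp [← Finset.disjoint_coe, hd]

/-- The probability of reaching `v` after exploring the cluster of `u` inside `S`. -/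
theorem measure_cluster_edge_conn {S Λ : Finset V} {u v x y : V} {C : Set V} (p : unitInterval)
    (hx : x ∈ C) (hy : y ∉ (S : Set V)) (hxy : G.Adj x y) :
    bondMeasure G p ({ω | clusterWithin G ω (S ∩ Λ : Set V) u = C} ∩
        ({ω | ω ⟨s(x, y), hxy⟩ = true} ∩ connWithin G ((Λ : Set V) \ C) y v)) =
      bondMeasure G p {ω | clusterWithin G ω (S ∩ Λ : Set V) u = C} *
        (ENNReal.ofReal p * bondMeasure G p (connWithin G ((Λ : Set V) \ C) y v)) := by
  have hΛ : (edgesWithin G ((Λ : Set V) \ C)).Finite :=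
    finite_edgesWithin (Λ.finite_toSet.subset sdiff_subset)
  have hS : (edgesWithin G (S ∩ Λ : Set V)).Finite :=
    finite_edgesWithin (S.finite_toSet.subset inter_subset_left)
  have h2 : ∀ e ∈ edgesWithin G ((Λ : Set V) \ C), ∀ w ∈ (e : Sym2 V), w ∉ C :=
    fun e he w hw => (he w hw).2
  -- The three events use disjoint edge sets: edges within `S` touching `C`, the edge xy leaving
  -- `S`, and edges avoiding `C`.
  rw [measure_inter_of_disjoint (F' := {⟨s(x, y), hxy⟩} ∪ edgesWithin G ((Λ : Set V) \ C)) p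
    (determinedBy_clusterWithin _ C u) ?_ (hS.subset fun e he => he.1)
    ((finite_singleton _).union hΛ) ?_,
    measure_inter_of_disjoint p (determinedBy_edge hxy)
      (determinedBy_connWithin _ y v) (finite_singleton _) hΛ ?_]
  · rw [bondMeasure_eq_coinMeasure, coinMeasure_apply_true]
  · rw [Set.disjoint_singleton_left]
    exact fun h => h2 _ h x (by simp) hx
  · exact ((determinedBy_edge hxy).mono subset_union_left).inter
      ((determinedBy_connWithin _ y v).mono subset_union_right)
  · rw [Set.disjoint_left]
    rintro e ⟨he1, w, hw, hwC⟩ (he2 | he2)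
    · rw [mem_singleton_iff] at he2
      subst he2
      exact hy (he1 y (by simp)).1
    · exact h2 e he2 w hw hwC

/-- First-exit inequality for the two-point function in a finite region. -/
theorem measure_connWithin_le {S Λ : Finset V} {u v : V} (p : unitInterval) (hu : u ∈ S)
    (hv : v ∉ S) [DecidableRel G.Adj] [DecidableEq V] :
    bondMeasure G p (connWithin G (Λ : Set V) u v) ≤
      ∑ x ∈ S, ∑ y ∈ Λ, if G.Adj x y ∧ y ∉ S then
        bondMeasure G p (connWithin G (S : Set V) u x) *
          (ENNReal.ofReal p * bondMeasure G p (connWithin G (Λ : Set V) y v)) else 0 := by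
  set P := bondMeasure G p
  set K : Configuration G → Set V := fun ω => clusterWithin G ω (S ∩ Λ : Set V) u with hK
  have hKS : ∀ ω, K ω ⊆ S := by
    intro ω x hx
    have hx : (openWithin G ω (S ∩ Λ : Set V)).Reachable u x := hx
    exact mem_of_reachable_openWithin (hx.mono
      (openWithin_mono inter_subset_left fun _ _ h => h)) hu
  set D : Finset V → V → V → Set (Configuration G) := fun C x y =>
    {ω | K ω = C} ∩ ({ω | ∃ h : G.Adj x y, ω ⟨s(x, y), h⟩ = true} ∩
      connWithin G ((Λ : Set V) \ C) y v) with hD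
  have hsub : connWithin G (Λ : Set V) u v ⊆ ⋃ C ∈ S.powerset, ⋃ x ∈ C, ⋃ y ∈ Λ.filter
      (fun y => G.Adj x y ∧ y ∉ S), D C x y := by
    intro ω hω
    obtain ⟨C, hC⟩ := (S.finite_toSet.subset (hKS ω)).exists_finset_coe
    obtain ⟨x, hx, y, hy, hxy, hyv⟩ := exists_last_exit (K := K ω) hω
      (SimpleGraph.Reachable.refl _) (fun h => hv (hKS ω h))
    -- The exit from the cluster is an exit from `S`: an open edge to a vertex of `S` would have put
    -- that vertex in the cluster.
    have hyS : y ∉ S := fun hyS => hy (SimpleGraph.Reachable.trans hx (SimpleGraph.Adj.reachable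
      ⟨hxy.1, ⟨hKS ω hx, hxy.2.1⟩, ⟨hyS, hxy.2.2⟩⟩))
    obtain ⟨ha, ho⟩ := openSubgraph_adj_iff.1 hxy.1
    simp only [mem_iUnion, Finset.mem_powerset, Finset.mem_filter]
    refine ⟨C, ?_, x, ?_, y, ⟨hxy.2.2, ha, hyS⟩, hC.symm, ⟨ha, ho⟩, ?_⟩
    · rw [← Finset.coe_subset, hC]
      exact hKS ω
    · rwa [← Finset.mem_coe, hC]
    · rw [hC]
      exact hyv
  have hbound : ∀ C x y, x ∈ C → G.Adj x y ∧ y ∉ S → P (D C x y) ≤ P {ω | K ω = C} *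
      (ENNReal.ofReal p * P (connWithin G (Λ : Set V) y v)) := by
    intro C x y hx hy
    have h1 := measure_cluster_edge_conn (Λ := Λ) (u := u) (v := v) p
      (Finset.mem_coe.2 hx) (fun h => hy.2 h) hy.1
    have h2 : {ω : Configuration G | ∃ h : G.Adj x y, ω ⟨s(x, y), h⟩ = true} =
        {ω | ω ⟨s(x, y), hy.1⟩ = true} := by
      ext ω
      simp [hy.1]
    simp only [hD, h2]
    refine h1.le.trans ?_
    gcongr
    exact connWithin_mono sdiff_subset y v
  -- Summing over the disjoint possibilities for the cluster restores the probability that `x`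
  -- belongs to it.
  have hcl : ∀ x, ∑ C ∈ S.powerset, (if x ∈ C then P {ω | K ω = C} else 0) ≤
      P (connWithin G (S : Set V) u x) := by
    intro x
    rw [← Finset.sum_filter, ← measure_biUnion_finset]
    · refine measure_mono ?_
      intro ω hω
      simp only [mem_iUnion, Finset.mem_filter] at hω
      obtain ⟨C, ⟨-, hx⟩, hω⟩ := hω
      have hω : K ω = C := hω
      have hx : x ∈ K ω := by rwa [hω]
      exact connWithin_mono inter_subset_left u x hx
    · intro C _ C' _ hne
      rw [Function.onFun, Set.disjoint_left]
      intro ω h1 h2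
      have h1 : K ω = C := h1
      exact hne (Finset.coe_injective (h1.symm.trans h2))
    · intro C _
      have hfin : (edgesWithin G (S ∩ Λ : Set V)).Finite :=
        finite_edgesWithin (S.finite_toSet.subset inter_subset_left)
      exact DeterminedBy.measurableSet (F := hfin.toFinset)
        ((determinedBy_clusterWithin _ _ u).mono (by simp))
  calc P (connWithin G (Λ : Set V) u v)
      ≤ ∑ C ∈ S.powerset, ∑ x ∈ C, ∑ y ∈ Λ.filter (fun y => G.Adj x y ∧ y ∉ S), P (D C x y) := by
        refine (measure_mono hsub).trans ((measure_biUnion_finset_le _ _).trans ?_)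
        refine Finset.sum_le_sum fun C _ => (measure_biUnion_finset_le _ _).trans ?_
        exact Finset.sum_le_sum fun x _ => measure_biUnion_finset_le _ _
    _ ≤ ∑ C ∈ S.powerset, ∑ x ∈ S, ∑ y ∈ Λ, if G.Adj x y ∧ y ∉ S then
          (if x ∈ C then P {ω | K ω = C} else 0) *
            (ENNReal.ofReal p * P (connWithin G (Λ : Set V) y v)) else 0 := by
        refine Finset.sum_le_sum fun C hC => ?_
        rw [Finset.mem_powerset] at hC
        refine (Finset.sum_le_sum fun x hx => ?_).trans
          (Finset.sum_le_sum_of_subset hC)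
        rw [Finset.sum_filter]
        refine Finset.sum_le_sum fun y _ => ?_
        split_ifs with h
        · exact hbound C x y hx h
        · exact le_rfl
    _ = ∑ x ∈ S, ∑ y ∈ Λ, if G.Adj x y ∧ y ∉ S then
          (∑ C ∈ S.powerset, if x ∈ C then P {ω | K ω = C} else 0) *
            (ENNReal.ofReal p * P (connWithin G (Λ : Set V) y v)) else 0 := by
        rw [Finset.sum_comm]
        refine Finset.sum_congr rfl fun x _ => ?_
        rw [Finset.sum_comm]
        refine Finset.sum_congr rfl fun y _ => ?_
        split_ifs with h
        · rw [Finset.sum_mul]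
        · simp
    _ ≤ _ := by
        refine Finset.sum_le_sum fun x _ => Finset.sum_le_sum fun y _ => ?_
        split_ifs with h
        · exact mul_le_mul_left (hcl x) _
        · exact le_rfl

/-- If every vertex has a finite neighbourhood of bounded size with flux at most `φ < 1`, then the
susceptibility of every finite region is bounded. -/
theorem sum_measure_connWithin_le {p : unitInterval} {n : ℕ} {φ : ℝ≥0∞} (hφ : φ < 1)
    (h : ∀ u, ∃ S : Finset V, u ∈ S ∧ S.card ≤ n ∧ boundaryFlux G p S u ≤ φ)
    (Λ : Finset V) (u : V) :
    ∑ v ∈ Λ, bondMeasure G p (connWithin G (Λ : Set V) u v) ≤ n / (1 - φ) := by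
  classical
  set P := bondMeasure G p
  set M : ℝ≥0∞ := ⨆ u, ∑ v ∈ Λ, P (connWithin G (Λ : Set V) u v) with hM
  have hle : ∀ u, ∑ v ∈ Λ, P (connWithin G (Λ : Set V) u v) ≤ M := fun u => le_iSup
    (fun u => ∑ v ∈ Λ, P (connWithin G (Λ : Set V) u v)) u
  -- Finiteness of `M` is what permits solving M ≤ n + φM for `M` at the end.
  have hMtop : M ≠ ⊤ := by
    refine ne_top_of_le_ne_top (ENNReal.natCast_ne_top Λ.card) (iSup_le fun u => ?_)
    refine (Finset.sum_le_sum fun v _ => prob_le_one).trans ?_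
    simp
  have hrec : ∀ u, ∑ v ∈ Λ, P (connWithin G (Λ : Set V) u v) ≤ n + φ * M := by
    intro u
    obtain ⟨S, huS, hS, hflux⟩ := h u
    rw [← Finset.sum_filter_add_sum_filter_not Λ (fun v => v ∈ S)]
    refine add_le_add ?_ ?_
    · refine (Finset.sum_le_sum fun v _ => prob_le_one).trans ?_
      simp only [Finset.sum_const, nsmul_eq_mul, mul_one]
      exact_mod_cast (Finset.card_le_card fun v hv => (Finset.mem_filter.1 hv).2).trans hS
    · calc ∑ v ∈ Λ with v ∉ S, P (connWithin G (Λ : Set V) u v)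
          ≤ ∑ v ∈ Λ with v ∉ S, ∑ x ∈ S, ∑ y ∈ Λ, (if G.Adj x y ∧ y ∉ S then
              P (connWithin G (S : Set V) u x) *
                (ENNReal.ofReal p * P (connWithin G (Λ : Set V) y v)) else 0) :=
            Finset.sum_le_sum fun v hv =>
              measure_connWithin_le p huS (Finset.mem_filter.1 hv).2
        _ ≤ ∑ v ∈ Λ, ∑ x ∈ S, ∑ y ∈ Λ, (if G.Adj x y ∧ y ∉ S then
              P (connWithin G (S : Set V) u x) *
                (ENNReal.ofReal p * P (connWithin G (Λ : Set V) y v)) else 0) :=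
            Finset.sum_le_sum_of_subset (Finset.filter_subset _ _)
        _ = ∑ x ∈ S, ∑ y ∈ Λ, (if G.Adj x y ∧ y ∉ S then
              ENNReal.ofReal p * P (connWithin G (S : Set V) u x) else 0) *
                ∑ v ∈ Λ, P (connWithin G (Λ : Set V) y v) := by
            rw [Finset.sum_comm]
            refine Finset.sum_congr rfl fun x _ => ?_
            rw [Finset.sum_comm]
            refine Finset.sum_congr rfl fun y _ => ?_
            split_ifs with h
            · rw [Finset.mul_sum]
              exact Finset.sum_congr rfl fun v _ => by ring
            · simp
        _ ≤ ∑ x ∈ S, ∑ y ∈ Λ, (if G.Adj x y ∧ y ∉ S then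
              ENNReal.ofReal p * P (connWithin G (S : Set V) u x) else 0) * M := by
            gcongr with x _ y _
            exact hle y
        _ = (∑ x ∈ S, ∑ y ∈ Λ, (if G.Adj x y ∧ y ∉ S then
              ENNReal.ofReal p * P (connWithin G (S : Set V) u x) else 0)) * M := by
            simp_rw [Finset.sum_mul]
        _ ≤ boundaryFlux G p S u * M := by
            gcongr
            unfold boundaryFlux
            refine Finset.sum_le_sum fun x _ => ?_
            exact (ENNReal.sum_le_tsum Λ).trans (le_of_eq (tsum_congr fun y => by congr))
        _ ≤ φ * M := by gcongr
  have hMle : M ≤ n + φ * M := iSup_le hrec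
  refine (hle u).trans ?_
  rw [ENNReal.le_div_iff_mul_le (Or.inl (tsub_pos_iff_lt.2 hφ).ne')
    (Or.inl (ne_top_of_le_ne_top ENNReal.one_ne_top tsub_le_self)),
    ENNReal.mul_sub (fun _ _ => hMtop), mul_one, mul_comm M φ]
  exact tsub_le_iff_right.2 hMle

/-- Under the same hypothesis, the susceptibility of the whole graph is bounded. -/
theorem sum_tau_le {Λ : ℕ → Finset V} (hmono : Monotone Λ) (hex : ∀ v, ∃ n, v ∈ Λ n)
    {p : unitInterval} {n : ℕ} {φ : ℝ≥0∞} (hφ : φ < 1)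
    (h : ∀ u, ∃ S : Finset V, u ∈ S ∧ S.card ≤ n ∧ boundaryFlux G p S u ≤ φ)
    (L : Finset V) (u : V) : ∑ v ∈ L, tau G p u v ≤ n / (1 - φ) := by
  simp_rw [tau_eq_iSup hmono hex]
  rw [ENNReal.finsetSum_iSup_of_monotone fun v m m' hm => measure_mono
    (connWithin_mono (Finset.coe_subset.2 (hmono hm)) u v)]
  refine iSup_le fun m => ?_
  choose f hf using hex
  set m' := max m (L.sup f)
  have hL : L ⊆ Λ m' := fun v hv =>
    hmono ((Finset.le_sup (f := f) hv).trans (le_max_right _ _)) (hf v)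
  calc ∑ v ∈ L, bondMeasure G p (connWithin G (Λ m : Set V) u v)
      ≤ ∑ v ∈ L, bondMeasure G p (connWithin G (Λ m' : Set V) u v) :=
        Finset.sum_le_sum fun v _ => measure_mono
          (connWithin_mono (Finset.coe_subset.2 (hmono (le_max_left _ _))) u v)
    _ ≤ ∑ v ∈ Λ m', bondMeasure G p (connWithin G (Λ m' : Set V) u v) :=
        Finset.sum_le_sum_of_subset hL
    _ ≤ _ := sum_measure_connWithin_le hφ h _ u

/-- The two-point function is supermultiplicative, by the Harris inequality. -/
theorem tau_mul_tau_le {Λ : ℕ → Finset V} (hmono : Monotone Λ) (hex : ∀ v, ∃ n, v ∈ Λ n)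
    (p : unitInterval) (x y z : V) : tau G p x y * tau G p y z ≤ tau G p x z := by
  have hm : ∀ x y, Monotone fun n => bondMeasure G p (connWithin G (Λ n : Set V) x y) :=
    fun x y m m' hm => measure_mono (connWithin_mono (Finset.coe_subset.2 (hmono hm)) x y)
  simp_rw [tau_eq_iSup hmono hex]
  rw [ENNReal.iSup_mul]
  refine iSup_le fun m => ?_
  rw [ENNReal.mul_iSup]
  refine iSup_le fun m' => ?_
  set n := max m m'
  refine (mul_le_mul' (hm x y (le_max_left m m')) (hm y z (le_max_right m m'))).trans ?_
  refine le_trans ?_ (le_iSup _ n)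
  -- Harris is applied inside a common finite region, where the events depend on finitely many
  -- edges.
  refine (coinMeasure_mul_le_inter p (determinedBy_connWithin_finset _ _ _)
    (determinedBy_connWithin_finset _ _ _) (increasing_connWithin _ _ _)
    (increasing_connWithin _ _ _)).trans (measure_mono ?_)
  exact fun ω h => SimpleGraph.Reachable.trans h.1 h.2

end Connectivity

/-! ### Pivotal form of Russo's formula. -/

section Russo

variable {E : Type*}

/-- The configurations that lie in `A` once the coordinate `e` is opened. -/
def openedAt (A : Set (E → Bool)) (e : E) : Set (E → Bool) :=
  open Classical in {ω | Function.update ω e true ∈ A}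

theorem mem_openedAt [DecidableEq E] {A : Set (E → Bool)} {e : E} {ω : E → Bool} :
    ω ∈ openedAt A e ↔ Function.update ω e true ∈ A := by
  have : (fun a b => Classical.propDecidable (a = b)) = ‹DecidableEq E› := Subsingleton.elim _ _
  subst this
  exact Iff.rfl

theorem DeterminedBy.openedAt {A : Set (E → Bool)} {F : Set E} (hA : DeterminedBy A F) (e : E) :
    DeterminedBy (openedAt A e) (F \ {e}) := by
  classical
  intro ω ω' h hω
  refine hA (Function.update ω e true) (Function.update ω' e true) (fun e' he' => ?_) hω
  by_cases hee : e' = e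
  · subst hee
    simp
  · simpa [hee] using h e' ⟨he', hee⟩

theorem Increasing.subset_openedAt {A : Set (E → Bool)} (hA : Increasing A) (e : E) :
    A ⊆ Percolation.openedAt A e := by
  classical
  intro ω hω
  refine hA ω (Function.update ω e true) (fun e' he' => ?_) hω
  by_cases hee : e' = e
  · subst hee
    simp
  · simpa [hee] using he'

/-- Russo's formula for increasing events. -/
theorem exists_hasDerivAt_coinPoly {A : Set (E → Bool)} {F : Finset E} {p : unitInterval}
    (hA : DeterminedBy A (F : Set E)) (hA' : Increasing A) (hp : 0 < (p : ℝ)) :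
    ∃ D, HasDerivAt (coinPoly F A) D p ∧
      (1 - p) * D = ∑ e ∈ F, (coinMeasure E p).real (openedAt A e \ A) := by
  classical
  obtain ⟨D, hD, hD'⟩ := hasDerivAt_coinPoly F A p
  refine ⟨D, hD, mul_left_cancel₀ hp.ne' ?_⟩
  rw [← mul_assoc, hD', Finset.mul_sum]
  refine Finset.sum_congr rfl fun e he => ?_
  have hedge : DeterminedBy {ω : E → Bool | ω e = true} {e} :=
    fun ω ω' h hω => (h e rfl).symm.trans hω
  have hop := hA.openedAt e
  rw [← Finset.coe_singleton, ← Finset.coe_sdiff] at hop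
  have hEF : DeterminedBy {ω : E → Bool | ω e = true} (F : Set E) :=
    hedge.mono (by simpa using he)
  rw [← coinMeasure_real_eq_coinPoly p (hA.inter hEF), ← coinMeasure_real_eq_coinPoly p hA,
    measureReal_sdiff (hA'.subset_openedAt e) hA.measurableSet, mul_sub]
  congr 1
  -- The event `openedAt A e` ignores the coordinate `e`, so the intersection factorises and each
  -- covariance is p times the probability of `openedAt A e \ A`.
  have hset : A ∩ {ω : E → Bool | ω e = true} = openedAt A e ∩ {ω : E → Bool | ω e = true} := by
    ext ω
    refine and_congr_left fun hω => ?_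
    have hω : ω e = true := hω
    have : Function.update ω e true = ω := by rw [← hω, Function.update_eq_self]
    show ω ∈ A ↔ Function.update ω e true ∈ A
    rw [this]
  rw [hset, measureReal_def, coinMeasure_inter (F := F \ {e}) (F' := {e}) p hop (by simpa)
    Finset.sdiff_disjoint, coinMeasure_apply_true, ENNReal.toReal_mul,
    ENNReal.toReal_ofReal p.2.1, mul_comm]
  rfl

end Russo

/-! ### Sharpness of the phase transition, after Duminil-Copin and Tassion. -/

section Exit

variable {V : Type*} {G : SimpleGraph V}

variable (G) in
/-- The event that `o` is joined to `Λ' \ Λ` by an open path inside `Λ'`. -/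
def exitEvent (Λ Λ' : Set V) (o : V) : Set (Configuration G) :=
  {ω | ∃ y ∈ Λ' \ Λ, (openWithin G ω Λ').Reachable o y}

variable (G) in
/-- The set of the vertices of `Λ` that are not joined to `Λ' \ Λ` inside `Λ'`. -/
def trapped (Λ Λ' : Set V) (ω : Configuration G) : Set V :=
  {x | x ∈ Λ ∧ ω ∉ exitEvent G Λ Λ' x}

theorem increasing_exitEvent (Λ Λ' : Set V) (o : V) : Increasing (exitEvent G Λ Λ' o) := by
  rintro ω ω' h ⟨y, hy, hω⟩
  exact ⟨y, hy, increasing_connWithin Λ' o y ω ω' h hω⟩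

theorem determinedBy_exitEvent (Λ Λ' : Set V) (o : V) :
    DeterminedBy (exitEvent G Λ Λ' o) (edgesWithin G Λ') := by
  rintro ω ω' h ⟨y, hy, hω⟩
  exact ⟨y, hy, determinedBy_connWithin Λ' o y ω ω' h hω⟩

/-- The set of trapped vertices is determined by the edges that are not inside it. -/
theorem determinedBy_trapped (Λ Λ' S : Set V) :
    DeterminedBy {ω | trapped G Λ Λ' ω = S} (edgesWithin G Λ' \ edgesWithin G S) := by
  intro ω ω' h hω
  change trapped G Λ Λ' ω = S at hω
  change trapped G Λ Λ' ω' = S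
  have hSΛ : S ⊆ Λ := hω ▸ fun x hx => hx.1
  have htrap : ∀ x ∈ S, ∀ y ∈ Λ' \ Λ, ¬ (openWithin G ω Λ').Reachable x y := by
    intro x hx y hy hxy
    rw [← hω] at hx
    exact hx.2 ⟨y, hy, hxy⟩
  have key : ∀ {a b}, ¬ (a ∈ S ∧ b ∈ S) → a ∈ Λ' → b ∈ Λ' → ∀ hab : G.Adj a b,
      ω ⟨s(a, b), hab⟩ = ω' ⟨s(a, b), hab⟩ := fun hS ha hb hab =>
    h _ ⟨(mem_edgesWithin hab).2 ⟨ha, hb⟩, fun h' => hS ((mem_edgesWithin hab).1 h')⟩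
  apply Subset.antisymm
  · rintro x ⟨hx, hx'⟩
    by_contra hxS
    have : ω ∈ exitEvent G Λ Λ' x := by
      by_contra hc
      exact hxS (hω ▸ ⟨hx, hc⟩)
    obtain ⟨y, hy, hxy⟩ := this
    refine hx' ⟨y, hy, ?_⟩
    -- An exit path never meets `S`, whose vertices are trapped, so all its edges have the same
    -- state in `ω'`.
    rw [SimpleGraph.reachable_iff_reflTransGen] at hxy
    clear hx hx' hxS
    induction hxy using Relation.ReflTransGen.head_induction_on with
    | refl => exact SimpleGraph.Reachable.refl _
    | head hab hby ih =>
      rename_i a b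
      refine SimpleGraph.Reachable.trans (SimpleGraph.Adj.reachable ?_) ih
      have haS : a ∉ S := fun haS => htrap a haS y hy
        (hab.reachable.trans ((SimpleGraph.reachable_iff_reflTransGen _ _).2 hby))
      exact ⟨openSubgraph_adj_congr (key (fun h => haS h.1) hab.2.1 hab.2.2) hab.1, hab.2⟩
  · intro x hx
    refine ⟨hSΛ hx, ?_⟩
    rintro ⟨y, hy, hxy⟩
    -- After its last visit to `S`, an exit path for `ω'` uses only edges not inside `S`. These
    -- agree with `ω`, so the last vertex `a` in `S` would not be trapped in `ω`.
    obtain ⟨a, ha, b, hb, hab, hby⟩ := exists_last_exit hxy hx (fun h => hy.2 (hSΛ h))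
    refine htrap a ha y hy (SimpleGraph.Reachable.trans (SimpleGraph.Adj.reachable
      (⟨openSubgraph_adj_congr (fun h => (key (fun h => hb h.2) hab.2.1 hab.2.2 h).symm) hab.1,
        hab.2⟩ : (openWithin G ω Λ').Adj a b)) (hby.mono (openWithin_mono sdiff_subset ?_)))
    rintro ⟨e, he⟩ he'
    induction e with
    | h c d =>
      obtain ⟨hc, hd⟩ := (mem_edgesWithin he).1 he'
      intro ho
      exact (key (fun h => hc.2 h.1) hc.1 hd.1 he).trans ho

theorem finite_setOf_edgesWithin_sdiff (Λ' : Finset V) (S : Set V) :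
    (edgesWithin G (Λ' : Set V) \ edgesWithin G S).Finite :=
  (finite_edgesWithin Λ'.finite_toSet).subset sdiff_subset

theorem measurableSet_trapped (Λ : Set V) (Λ' : Finset V) (S : Set V) :
    MeasurableSet {ω | trapped G Λ Λ' ω = S} :=
  DeterminedBy.measurableSet (F := (finite_setOf_edgesWithin_sdiff Λ' S).toFinset)
    (by simpa using determinedBy_trapped Λ (Λ' : Set V) S)

/-- Opening a boundary edge of the set of trapped vertices at a vertex joined to `o` makes the
exit event occur. -/
theorem trapped_inter_connWithin_subset {Λ Λ' S : Set V} (hΛ : Λ ⊆ Λ') {o x y : V} (ho : o ∈ S)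
    (hx : x ∈ S) (hxy : G.Adj x y) (hyS : y ∉ S) (hy : y ∈ Λ') :
    {ω | trapped G Λ Λ' ω = S} ∩ connWithin G S o x ⊆
      (openedAt (exitEvent G Λ Λ' o) ⟨s(x, y), hxy⟩ \ exitEvent G Λ Λ' o) ∩
        {ω | trapped G Λ Λ' ω = S} := by
  classical
  rintro ω ⟨hω, hox⟩
  have hω' : trapped G Λ Λ' ω = S := hω
  have hSΛ : S ⊆ Λ := hω' ▸ fun x hx => hx.1
  refine ⟨⟨?_, ?_⟩, hω⟩
  · rw [mem_openedAt]
    set ω₁ := Function.update ω (⟨s(x, y), hxy⟩ : G.edgeSet) true with hω₁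
    have hle : ∀ e, ω e = true → ω₁ e = true := by
      intro e he
      by_cases hee : e = ⟨s(x, y), hxy⟩
      · simp [hω₁, hee]
      · simpa [hω₁, hee] using he
    have h1 : (openWithin G ω₁ Λ').Reachable o x :=
      SimpleGraph.Reachable.mono (openWithin_mono (hSΛ.trans hΛ) fun e _ => hle e) hox
    have h2 : (openWithin G ω₁ Λ').Adj x y :=
      ⟨openSubgraph_adj_iff.2 ⟨hxy, by simp [hω₁]⟩, hΛ (hSΛ hx), hy⟩
    -- An untrapped `y` inside `Λ` has its own exit path; outside `Λ`, it is itself an exit.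
    by_cases hyΛ : y ∈ Λ
    · have : ω ∈ exitEvent G Λ Λ' y := by
        by_contra hc
        exact hyS (hω' ▸ ⟨hyΛ, hc⟩)
      obtain ⟨z, hz, hyz⟩ := this
      exact ⟨z, hz, h1.trans (h2.reachable.trans
        (hyz.mono (openWithin_mono subset_rfl fun e _ => hle e)))⟩
    · exact ⟨y, ⟨hy, hyΛ⟩, h1.trans h2.reachable⟩
  · rw [← hω'] at ho
    exact ho.2

/-- The differential inequality of Duminil-Copin and Tassion, before differentiation. -/
theorem measure_compl_exitEvent_le {Λ Λ' : Finset V} (hΛ : Λ ⊆ Λ') {o : V} (ho : o ∈ Λ)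
    (hN : ∀ x ∈ Λ, ∀ y, G.Adj x y → y ∈ Λ') {p : unitInterval}
    (hflux : ∀ S : Finset V, o ∈ S → 1 ≤ boundaryFlux G p S o) :
    bondMeasure G p (exitEvent G (Λ : Set V) Λ' o)ᶜ ≤
      ENNReal.ofReal p * ∑ e ∈ edgeFinsetWithin Λ', bondMeasure G p
        (openedAt (exitEvent G (Λ : Set V) Λ' o) e \ exitEvent G (Λ : Set V) Λ' o) := by
  classical
  set P := bondMeasure G p
  set A := exitEvent G (Λ : Set V) (Λ' : Set V) o
  set B : Finset V → Set (Configuration G) := fun S => {ω | trapped G (Λ : Set V) Λ' ω = S} with hB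
  set 𝒮 := Λ.powerset.filter (fun S => o ∈ S)
  have hBdisj : ∀ S S' : Finset V, S ≠ S' → Disjoint (B S) (B S') := by
    intro S S' hne
    rw [Set.disjoint_left]
    intro ω (h1 : _ = _) (h2 : _ = _)
    exact hne (Finset.coe_injective (h1.symm.trans h2))
  have hcover : Aᶜ ⊆ ⋃ S ∈ 𝒮, B S := by
    intro ω hω
    have hsub : trapped G (Λ : Set V) Λ' ω ⊆ Λ := fun x hx => hx.1
    obtain ⟨S, hS⟩ := (Λ.finite_toSet.subset hsub).exists_finset_coe
    simp only [mem_iUnion]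
    refine ⟨S, Finset.mem_filter.2 ⟨Finset.mem_powerset.2 ?_, ?_⟩, hS.symm⟩
    · rw [← Finset.coe_subset, hS]
      exact hsub
    · rw [← Finset.mem_coe, hS]
      exact ⟨ho, hω⟩
  -- The event `B S` is independent of connections inside `S`, so multiplying it by the flux, which
  -- is at least 1, counts edges whose opening creates an exit.
  have hpiv : ∀ S ∈ 𝒮, P (B S) ≤ ENNReal.ofReal p *
      ∑ e ∈ edgeFinsetWithin Λ', P ((openedAt A e \ A) ∩ B S) := by
    intro S hS
    obtain ⟨hSΛ, hoS⟩ := Finset.mem_filter.1 hS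
    rw [Finset.mem_powerset] at hSΛ
    set Q := (S ×ˢ Λ').filter (fun q => G.Adj q.1 q.2 ∧ q.2 ∉ S) with hQ
    have hQ' : ∀ q : Q, q.1.1 ∈ S ∧ q.1.2 ∈ Λ' ∧ G.Adj q.1.1 q.1.2 ∧ q.1.2 ∉ S := by
      intro q
      have := Finset.mem_filter.1 q.2
      rw [Finset.mem_product] at this
      exact ⟨this.1.1, this.1.2, this.2⟩
    set i : Q → G.edgeSet := fun q => ⟨s(q.1.1, q.1.2), (hQ' q).2.2.1⟩ with hi
    -- A boundary edge has only one orientation from `S` to its complement.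
    have hinj : Function.Injective i := by
      intro q q' h
      have h' : s(q.1.1, q.1.2) = s(q'.1.1, q'.1.2) := congrArg Subtype.val h
      rw [Sym2.eq_iff] at h'
      rcases h' with ⟨h1, h2⟩ | ⟨h1, h2⟩
      · exact Subtype.ext (Prod.ext h1 h2)
      · exact absurd (h1 ▸ (hQ' q).1) (hQ' q').2.2.2
    have hmem : ∀ q, i q ∈ edgeFinsetWithin Λ' := by
      intro q
      rw [← Finset.mem_coe, coe_edgeFinsetWithin]
      exact (mem_edgesWithin _).2 ⟨hΛ (hSΛ (hQ' q).1), (hQ' q).2.1⟩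
    have hterm : ∀ q, P (B S) * P (connWithin G (S : Set V) o q.1.1) ≤
        P ((openedAt A (i q) \ A) ∩ B S) := by
      intro q
      rw [← measure_inter_of_disjoint p (determinedBy_trapped (Λ : Set V) (Λ' : Set V) (S : Set V))
        (determinedBy_connWithin (S : Set V) o q.1.1) (finite_setOf_edgesWithin_sdiff Λ' S)
        (finite_edgesWithin S.finite_toSet) disjoint_sdiff_left]
      exact measure_mono (trapped_inter_connWithin_subset (Finset.coe_subset.2 hΛ) hoS (hQ' q).1
        (hQ' q).2.2.1 (hQ' q).2.2.2 (hQ' q).2.1)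
    have hfl : boundaryFlux G p S o =
        ENNReal.ofReal p * ∑ q : Q, P (connWithin G (S : Set V) o q.1.1) := by
      rw [Finset.sum_coe_sort Q (fun q => P (connWithin G (S : Set V) o q.1)), hQ,
        Finset.sum_filter, Finset.sum_product, Finset.mul_sum]
      unfold boundaryFlux
      refine Finset.sum_congr rfl fun x hx => ?_
      rw [tsum_eq_sum (s := Λ'), Finset.mul_sum]
      · refine Finset.sum_congr rfl fun y _ => ?_
        by_cases h : G.Adj x y ∧ y ∉ S <;> simp [h, P]
      · intro y hy
        rw [if_neg fun h => hy (hN x (hSΛ hx) y h.1)]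
    calc P (B S) ≤ P (B S) * boundaryFlux G p S o := le_mul_of_one_le_right' (hflux S hoS)
      _ = ENNReal.ofReal p * ∑ q : Q, P (B S) * P (connWithin G (S : Set V) o q.1.1) := by
          rw [hfl, ← Finset.mul_sum]
          ring
      _ ≤ ENNReal.ofReal p * ∑ q : Q, P ((openedAt A (i q) \ A) ∩ B S) := by
          gcongr with q
          exact hterm q
      _ = ENNReal.ofReal p * ∑ e ∈ Finset.univ.image i, P ((openedAt A e \ A) ∩ B S) := by
          rw [Finset.sum_image hinj.injOn]
      _ ≤ _ := by
          refine mul_le_mul_right (Finset.sum_le_sum_of_subset ?_) _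
          intro e he
          obtain ⟨q, -, rfl⟩ := Finset.mem_image.1 he
          exact hmem q
  calc P Aᶜ ≤ ∑ S ∈ 𝒮, P (B S) := (measure_mono hcover).trans (measure_biUnion_finset_le _ _)
    _ ≤ ∑ S ∈ 𝒮, ENNReal.ofReal p *
        ∑ e ∈ edgeFinsetWithin Λ', P ((openedAt A e \ A) ∩ B S) := Finset.sum_le_sum hpiv
    _ = ENNReal.ofReal p * ∑ e ∈ edgeFinsetWithin Λ', ∑ S ∈ 𝒮, P (B S ∩ (openedAt A e \ A)) := by
        rw [← Finset.mul_sum, Finset.sum_comm]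
        simp_rw [inter_comm]
    _ ≤ _ := by
        refine mul_le_mul_right (Finset.sum_le_sum fun e _ => ?_) _
        have := sum_measure_le_measure_univ (μ := P.restrict (openedAt A e \ A)) (s := 𝒮) (t := B)
          (fun S _ => (measurableSet_trapped _ Λ' _).nullMeasurableSet)
          (fun S _ S' _ hne => (hBdisj S S' hne).aedisjoint)
        rw [Measure.restrict_apply_univ] at this
        refine (Finset.sum_le_sum fun S _ => ?_).trans this
        rw [Measure.restrict_apply (measurableSet_trapped _ Λ' _)]

/-- Sharpness, in finite volume: if the flux through every finite set is at least one for all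
parameters in `[a, b]`, then the exit probability at `b` is bounded below. -/
theorem one_sub_exit_le {Λ Λ' : Finset V} (hΛ : Λ ⊆ Λ') {o : V} (ho : o ∈ Λ)
    (hN : ∀ x ∈ Λ, ∀ y, G.Adj x y → y ∈ Λ') {a b : unitInterval} (ha : 0 < (a : ℝ))
    (hab : a < b) (hb : (b : ℝ) < 1)
    (hflux : ∀ p ∈ Icc a b, ∀ S : Finset V, o ∈ S → 1 ≤ boundaryFlux G p S o) :
    (bondMeasure G b).real (exitEvent G (Λ : Set V) Λ' o)ᶜ ≤ (a * (1 - b)) / (b * (1 - a)) := by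
  classical
  set A := exitEvent G (Λ : Set V) (Λ' : Set V) o
  set F : Finset G.edgeSet := edgeFinsetWithin Λ' with hF
  have hdet : DeterminedBy A (F : Set G.edgeSet) := by
    rw [hF, coe_edgeFinsetWithin]
    exact determinedBy_exitEvent _ _ _
  have hinc : Increasing A := increasing_exitEvent _ _ _
  have hab' : (a : ℝ) < b := hab
  have hcompl : ∀ p : unitInterval, (bondMeasure G p).real Aᶜ = 1 - coinPoly F A p := by
    intro p
    rw [probReal_compl_eq_one_sub hdet.measurableSet, bondMeasure_eq_coinMeasure,
      coinMeasure_real_eq_coinPoly p hdet]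
  have hder : ∀ t ∈ Icc (a : ℝ) b, ∃ D, HasDerivAt (coinPoly F A) D t ∧
      1 - coinPoly F A t ≤ t * ((1 - t) * D) := by
    intro t ht
    have ht0 : 0 < t := ha.trans_le ht.1
    set p : unitInterval := ⟨t, ht0.le, ht.2.trans hb.le⟩ with hp
    obtain ⟨D, hD, hD'⟩ := exists_hasDerivAt_coinPoly (p := p) hdet hinc ht0
    refine ⟨D, hD, ?_⟩
    have h := measure_compl_exitEvent_le hΛ ho hN (hflux p ⟨ht.1, ht.2⟩)
    have h2 := ENNReal.toReal_mono (ENNReal.mul_ne_top ENNReal.ofReal_ne_top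
      (ENNReal.sum_ne_top.2 fun e _ => measure_ne_top _ _)) h
    rw [ENNReal.toReal_mul, ENNReal.toReal_sum (fun e _ => measure_ne_top _ _),
      ENNReal.toReal_ofReal p.2.1] at h2
    have h3 := hcompl p
    rw [← h3]
    refine h2.trans (le_of_eq ?_)
    change _ = (p : ℝ) * ((1 - p) * D)
    rw [hD']
    rfl
  choose! D hD hD' using hder
  have hlt1 : ∀ t ∈ Icc (a : ℝ) b, 0 < 1 - t := fun t ht => sub_pos.2 (ht.2.trans_lt hb)
  have hh : ∀ t ∈ Icc (a : ℝ) b, HasDerivAt (fun t => (1 - coinPoly F A t) * (t / (1 - t)))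
      (-D t * (t / (1 - t)) + (1 - coinPoly F A t) * ((1 * (1 - t) - t * -1) / (1 - t) ^ 2)) t := by
    intro t ht
    exact ((hD t ht).const_sub 1).mul
      ((hasDerivAt_id t).div ((hasDerivAt_id t).const_sub 1) (hlt1 t ht).ne')
  -- The inequality 1 - f ≤ t(1-t)f' is integrated with the factor t/(1-t), whose logarithmic
  -- derivative is 1/(t(1-t)).
  have hanti : AntitoneOn (fun t => (1 - coinPoly F A t) * (t / (1 - t))) (Icc (a : ℝ) b) := by
    refine antitoneOn_of_deriv_nonpos (convex_Icc _ _)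
      (fun t ht => (hh t ht).continuousAt.continuousWithinAt)
      (fun t ht => (hh t (interior_subset ht)).differentiableAt.differentiableWithinAt)
      fun t ht => ?_
    have ht' := interior_subset ht
    rw [(hh t ht').deriv]
    have h1 := hlt1 t ht'
    have h2 := hD' t ht'
    have : -D t * (t / (1 - t)) + (1 - coinPoly F A t) * ((1 * (1 - t) - t * -1) / (1 - t) ^ 2) =
        ((1 - coinPoly F A t) - t * ((1 - t) * D t)) / (1 - t) ^ 2 := by
      field_simp
      ring
    rw [this]
    exact div_nonpos_of_nonpos_of_nonneg (by linarith) (by positivity)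
  have hfin := hanti (left_mem_Icc.2 hab'.le) (right_mem_Icc.2 hab'.le) hab'.le
  have hfa : 1 - coinPoly F A a ≤ 1 := by
    rw [← hcompl]
    exact measureReal_le_one
  have ha1 : 0 < 1 - (a : ℝ) := by linarith
  have hb1 : 0 < 1 - (b : ℝ) := by linarith
  have hb0 : 0 < (b : ℝ) := by linarith
  rw [hcompl]
  have h5 : (1 - coinPoly F A b) * (b / (1 - b)) ≤ a / (1 - a) :=
    hfin.trans (mul_le_of_le_one_left (by positivity) hfa)
  calc 1 - coinPoly F A b = ((1 - coinPoly F A b) * (b / (1 - b))) * ((1 - b) / b) := by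
        field_simp
    _ ≤ a / (1 - a) * ((1 - b) / b) := by gcongr
    _ = _ := by
        field_simp

/-- Sharpness: if the flux through every finite set is at least one for all parameters in `[a, b]`,
then percolation occurs at `b` with positive probability. -/
theorem existsInfiniteCluster_pos {Λ : ℕ → Finset V} (hmono : Monotone Λ)
    (hex : ∀ v, ∃ n, v ∈ Λ n) (hfin : ∀ v, (G.neighborSet v).Finite) {o : V}
    {a b : unitInterval} (ha : 0 < (a : ℝ)) (hab : a < b) (hb : (b : ℝ) < 1)
    (hflux : ∀ p ∈ Icc a b, ∀ S : Finset V, o ∈ S → 1 ≤ boundaryFlux G p S o) :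
    0 < bondMeasure G b (existsInfiniteCluster G) := by
  classical
  have hab' : (a : ℝ) < b := hab
  have ha1 : 0 < 1 - (a : ℝ) := by linarith
  have hb0 : 0 < (b : ℝ) := by linarith
  set c : ℝ := (a * (1 - b)) / (b * (1 - a)) with hc
  have hc1 : c < 1 := by
    rw [hc, div_lt_one (by positivity)]
    nlinarith
  set N : ℕ → Set (Configuration G) := fun n => {ω | ∀ y, (openSubgraph G ω).Reachable o y → y ∈ Λ n}
  have hNmono : Monotone N := fun m n hmn ω hω y hy => hmono hmn (hω y hy)
  -- The bound is uniform in `n`. The region `Λ₁` is taken to contain `o`, and `Λ₂` adds its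
  -- neighbours, as the finite-volume estimate demands.
  have hNle : ∀ n, bondMeasure G b (N n) ≤ ENNReal.ofReal c := by
    intro n
    obtain ⟨m, hm⟩ := hex o
    set Λ₁ := Λ (max m n)
    set Λ₂ := Λ₁ ∪ Λ₁.biUnion fun v => (hfin v).toFinset
    have h := one_sub_exit_le (Λ := Λ₁) (Λ' := Λ₂) Finset.subset_union_left
      (hmono (le_max_left m n) hm) (fun x hx y hxy => Finset.mem_union_right _
        (Finset.mem_biUnion.2 ⟨x, hx, by simpa using hxy⟩)) ha hab hb hflux
    rw [← ENNReal.ofReal_toReal (measure_ne_top (bondMeasure G b) (N n))]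
    refine ENNReal.ofReal_le_ofReal (le_trans (measureReal_mono ?_) h)
    rintro ω hω ⟨y, hy, hoy⟩
    refine hy.2 (hmono (le_max_right m n) (hω y ?_))
    have := connWithin_mono (subset_univ _) o y hoy
    rwa [connWithin_univ] at this
  have hcover : univ ⊆ existsInfiniteCluster G ∪ ⋃ n, N n := by
    intro ω _
    by_cases hω : ω ∈ existsInfiniteCluster G
    · exact Or.inl hω
    · refine Or.inr ?_
      have hfinC : ((openSubgraph G ω).connectedComponentMk o).supp.Finite := by
        by_contra h
        exact hω ⟨_, h⟩
      choose f hf using hex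
      refine mem_iUnion.2 ⟨hfinC.toFinset.sup f, fun y hy => ?_⟩
      refine hmono (Finset.le_sup (f := f) (hfinC.mem_toFinset.2 ?_)) (hf y)
      rw [SimpleGraph.ConnectedComponent.mem_supp_iff, SimpleGraph.ConnectedComponent.eq]
      exact hy.symm
  -- Subadditivity and continuity along increasing unions suffice; measurability of the percolation
  -- event plays no role.
  have h1 : (1 : ℝ≥0∞) ≤ bondMeasure G b (existsInfiniteCluster G) + ENNReal.ofReal c := by
    calc (1 : ℝ≥0∞) = bondMeasure G b univ := measure_univ.symm
      _ ≤ _ := (measure_mono hcover).trans (measure_union_le _ _)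
      _ ≤ _ := by
        gcongr
        rw [hNmono.measure_iUnion]
        exact iSup_le hNle
  by_contra h0
  rw [nonpos_iff_eq_zero.1 (not_lt.1 h0), zero_add] at h1
  exact absurd h1 (not_le.2 (ENNReal.ofReal_lt_one.2 hc1))

/-- At the critical probability, every parameter below can be increased, staying below, to one at
which some finite set has flux less than one. -/
theorem exists_boundaryFlux_lt_one {Λ : ℕ → Finset V} (hmono : Monotone Λ)
    (hex : ∀ v, ∃ n, v ∈ Λ n) (hfin : ∀ v, (G.neighborSet v).Finite) (o : V)
    {a : unitInterval} (ha : 0 < (a : ℝ)) (hac : a < criticalProbability G) :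
    ∃ p ∈ Ico a (criticalProbability G), ∃ S : Finset V, o ∈ S ∧ boundaryFlux G p S o < 1 := by
  by_contra! h
  -- If all fluxes on [a, p_c) were at least 1, percolation would occur at this `b` below p_c.
  -- Letting `p` vary in that interval dispenses with monotonicity of the flux.
  obtain ⟨b, hab, hbc⟩ := exists_between hac
  have hb1 : (b : ℝ) < 1 := (Subtype.coe_lt_coe.2 hbc).trans_le (criticalProbability G).2.2
  have hpos := existsInfiniteCluster_pos hmono hex hfin (o := o) ha hab hb1
    fun p hp S hS => h p ⟨hp.1, hp.2.trans_lt hbc⟩ S hS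
  exact absurd hbc (not_lt.2 (sInf_le hpos))

end Exit

/-! ### Invariance under graph isomorphisms. -/

section Isomorphism

variable {V V' : Type*} {G : SimpleGraph V} {G' : SimpleGraph V'}

/-- Transport of a configuration along an isomorphism of graphs. -/
def openWithinIso (e : G ≃g G') {ω : Configuration G} {ω' : Configuration G'}
    (h : ∀ d, ω' (e.mapEdgeSet d) = ω d) (S : Set V) :
    openWithin G ω S ≃g openWithin G' ω' (e '' S) where
  toEquiv := e.toEquiv
  map_rel_iff' := by
    intro x y
    have key : ∀ hxy : G.Adj x y, ω' ⟨s(e x, e y), e.map_adj_iff.2 hxy⟩ = ω ⟨s(x, y), hxy⟩ :=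
      fun hxy => h ⟨s(x, y), hxy⟩
    change (openSubgraph G' ω').Adj (e x) (e y) ∧ e x ∈ e '' S ∧ e y ∈ e '' S ↔
      (openSubgraph G ω).Adj x y ∧ x ∈ S ∧ y ∈ S
    rw [e.injective.mem_set_image, e.injective.mem_set_image, openSubgraph_adj_iff,
      openSubgraph_adj_iff]
    refine and_congr_left fun _ => ⟨?_, ?_⟩
    · rintro ⟨h1, h2⟩
      exact ⟨e.map_adj_iff.1 h1, (key (e.map_adj_iff.1 h1)).symm.trans h2⟩
    · rintro ⟨h1, h2⟩
      exact ⟨e.map_adj_iff.2 h1, (key h1).trans h2⟩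

theorem measure_connWithin_image (e : G ≃g G') (p : unitInterval) (S : Set V) (x y : V) :
    bondMeasure G' p (connWithin G' (e '' S) (e x) (e y)) =
      bondMeasure G p (connWithin G S x y) := by
  have hmap := Measure.infinitePi_map_piCongrLeft (X := fun _ : G'.edgeSet => Bool)
    (μ := fun _ => bernoulliMeasure true false p) e.mapEdgeSet
  have h : bondMeasure G' p = (bondMeasure G p).map
      (MeasurableEquiv.piCongrLeft (fun _ : G'.edgeSet => Bool) e.mapEdgeSet) := hmap.symm
  rw [h, MeasurableEquiv.map_apply]
  congr 1
  ext ω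
  exact (openWithinIso e (ω := ω) (fun d => MeasurableEquiv.piCongrLeft_apply_apply
    (β := fun _ : G'.edgeSet => Bool) e.mapEdgeSet ω d) S).reachable_iff

theorem tau_map (e : G ≃g G') (p : unitInterval) (x y : V) :
    tau G' p (e x) (e y) = tau G p x y := by
  rw [tau_eq_connWithin_univ, tau_eq_connWithin_univ, ← measure_connWithin_image e p univ x y,
    image_univ, e.surjective.range_eq]

theorem boundaryFlux_map (e : G ≃g G') (p : unitInterval) (S : Finset V) (o : V) :
    boundaryFlux G' p (S.map e.toEquiv.toEmbedding) (e o) = boundaryFlux G p S o := by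
  classical
  unfold boundaryFlux
  rw [Finset.sum_map]
  refine Finset.sum_congr rfl fun x _ => ?_
  rw [← e.toEquiv.tsum_eq]
  refine tsum_congr fun y => ?_
  have h1 : G'.Adj (e x) (e y) ↔ G.Adj x y := e.map_adj_iff
  have h2 : e y ∈ S.map e.toEquiv.toEmbedding ↔ y ∈ S := Finset.mem_map_equiv.trans (by
    show e.symm (e y) ∈ S ↔ y ∈ S
    rw [e.symm_apply_apply])
  have h3 := measure_connWithin_image e p (S : Set V) o x
  have h4 : ((S.map e.toEquiv.toEmbedding : Finset V') : Set V') = e '' (S : Set V) :=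
    Finset.coe_map _ _
  change (if G'.Adj (e x) (e y) ∧ e y ∉ S.map e.toEquiv.toEmbedding then ENNReal.ofReal p *
    bondMeasure G' p (connWithin G' (S.map e.toEquiv.toEmbedding : Finset V') (e o) (e x)) else 0) =
    _
  rw [h4, h3]
  by_cases hc : G.Adj x y ∧ y ∉ S
  · rw [if_pos hc, if_pos ⟨h1.2 hc.1, fun h => hc.2 (h2.1 h)⟩]
  · rw [if_neg hc, if_neg fun h => hc ⟨h1.1 h.1, fun h' => h.2 (h2.2 h')⟩]

/-- In a transitive graph, the susceptibility is finite as soon as some finite set has flux less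
than one. -/
theorem exists_sum_tau_le {Λ : ℕ → Finset V} (hmono : Monotone Λ) (hex : ∀ v, ∃ n, v ∈ Λ n)
    (htrans : ∀ x y, ∃ e : G ≃g G, e x = y) {p : unitInterval} {S : Finset V} {o : V}
    (ho : o ∈ S) (hS : boundaryFlux G p S o < 1) :
    ∃ C : ℝ≥0∞, C ≠ ⊤ ∧ ∀ (L : Finset V) (u : V), ∑ v ∈ L, tau G p u v ≤ C := by
  refine ⟨S.card / (1 - boundaryFlux G p S o), ENNReal.div_ne_top (ENNReal.natCast_ne_top _)
    (tsub_pos_iff_lt.2 hS).ne', fun L u => sum_tau_le hmono hex hS (fun v => ?_) L u⟩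
  obtain ⟨e, rfl⟩ := htrans o v
  exact ⟨S.map e.toEquiv.toEmbedding, Finset.mem_map_of_mem _ ho, (Finset.card_map _).le,
    (boundaryFlux_map e p S o).le⟩

/-- The product of isomorphisms is an isomorphism of Cartesian products. -/
def cartesianProductIso {ι : Type*} {V V' : ι → Type*} {T : ∀ i, SimpleGraph (V i)}
    {T' : ∀ i, SimpleGraph (V' i)} (e : ∀ i, T i ≃g T' i) :
    cartesianProduct T ≃g cartesianProduct T' where
  toEquiv := Equiv.piCongrRight fun i => (e i).toEquiv
  map_rel_iff' := by
    intro x y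
    change (∃ i, (T' i).Adj (e i (x i)) (e i (y i)) ∧ ∀ j, j ≠ i → e j (x j) = e j (y j)) ↔
      ∃ i, (T i).Adj (x i) (y i) ∧ ∀ j, j ≠ i → x j = y j
    simp [SimpleGraph.Iso.map_adj_iff]

end Isomorphism

/-! ### Spheres, geodesics and medians in regular trees. -/

section Trees

variable {V : Type*} {T : SimpleGraph V}

/-- A vertex other than the root has a neighbour that is closer to the root. -/
theorem exists_adj_dist_succ (hT : T.Connected) {r v : V} (h : v ≠ r) :
    ∃ u, T.Adj u v ∧ T.dist r v = T.dist r u + 1 := by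
  obtain ⟨p, hp⟩ := hT.exists_walk_length_eq_dist v r
  cases p with
  | nil => exact absurd rfl h
  | @cons _ w _ hvw q =>
    refine ⟨w, hvw.symm, ?_⟩
    have h1 := SimpleGraph.dist_le q
    have h2 := hT.dist_triangle (u := v) (v := w) (w := r)
    rw [SimpleGraph.dist_eq_one_iff_adj.2 hvw] at h2
    rw [SimpleGraph.Walk.length_cons] at hp
    rw [T.dist_comm (u := r), T.dist_comm (u := r)]
    omega

/-- In a tree, the neighbour closer to the root is unique. -/
theorem eq_of_adj_dist_succ (hT : T.IsTree) {r a b v : V} (ha : T.Adj a v) (hb : T.Adj b v)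
    (ha' : T.dist r v = T.dist r a + 1) (hb' : T.dist r v = T.dist r b + 1) : a = b := by
  obtain ⟨p, hp⟩ := hT.connected.exists_walk_length_eq_dist r a
  obtain ⟨q, hq⟩ := hT.connected.exists_walk_length_eq_dist r b
  -- Two geodesics from `r` to `v` coincide, hence so do their penultimate vertices.
  have h1 : (p.concat ha).IsPath := SimpleGraph.Walk.isPath_of_length_eq_dist _ (by simp [hp, ha'])
  have h2 : (q.concat hb).IsPath := SimpleGraph.Walk.isPath_of_length_eq_dist _ (by simp [hq, hb'])
  have h3 := (hT.existsUnique_path r v).unique h1 h2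
  simpa using congrArg SimpleGraph.Walk.penultimate h3

variable (T) in
/-- The children of `u` in the tree `T` rooted at `r`. -/
def children (r u : V) : Set V := {c | T.Adj u c ∧ T.dist r c = T.dist r u + 1}

theorem ncard_children_root [T.LocallyFinite] {k : ℕ} (hk : T.IsRegularOfDegree k) (r : V) :
    (children T r r).ncard = k := by
  have : children T r r = (T.neighborFinset r : Set V) := by
    ext c
    simp only [children, mem_ofPred_eq, SimpleGraph.coe_neighborFinset, SimpleGraph.mem_neighborSet]
    refine ⟨fun h => h.1, fun h => ⟨h, ?_⟩⟩
    rw [SimpleGraph.dist_eq_one_iff_adj.2 h, SimpleGraph.dist_self]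
  rw [this, Set.ncard_coe_finset, SimpleGraph.card_neighborFinset_eq_degree, hk r]

theorem finite_children [T.LocallyFinite] (r u : V) : (children T r u).Finite :=
  (T.neighborFinset u).finite_toSet.subset fun c hc => by simpa using hc.1

theorem ncard_children_of_ne [T.LocallyFinite] (hT : T.IsTree) {k : ℕ}
    (hk : T.IsRegularOfDegree k) {r u : V} (h : u ≠ r) : (children T r u).ncard = k - 1 := by
  obtain ⟨v, hv, hv'⟩ := exists_adj_dist_succ hT.connected h
  have hset : (T.neighborFinset u : Set V) = insert v (children T r u) := by
    ext c
    simp only [children, mem_insert_iff, mem_ofPred_eq, SimpleGraph.coe_neighborFinset,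
      SimpleGraph.mem_neighborSet]
    constructor
    · intro hc
      rcases hT.dist_eq_dist_add_one_of_adj r hc with h1 | h1
      · exact Or.inl (eq_of_adj_dist_succ hT hc.symm hv h1 hv')
      · exact Or.inr ⟨hc, h1⟩
    · rintro (rfl | hc)
      · exact hv.symm
      · exact hc.1
  have hnot : v ∉ children T r u := fun hc => by have := hc.2; omega
  have h1 := Set.ncard_insert_of_notMem hnot (finite_children r u)
  rw [← hset, Set.ncard_coe_finset, SimpleGraph.card_neighborFinset_eq_degree, hk u] at h1
  omega

theorem children_nonempty [T.LocallyFinite] (hT : T.IsTree) {k : ℕ}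
    (hk : T.IsRegularOfDegree k) (hk2 : 2 ≤ k) (r u : V) : (children T r u).Nonempty := by
  rw [← Set.ncard_pos (finite_children r u)]
  by_cases h : u = r
  · subst h
    rw [ncard_children_root hk]
    omega
  · rw [ncard_children_of_ne hT hk h]
    omega

variable (T) in
/-- The sphere of radius `n` around `r`. -/
noncomputable def sphere [T.LocallyFinite] (r : V) : ℕ → Finset V
  | 0 => {r}
  | n + 1 => open Classical in (sphere r n).biUnion fun u => (finite_children (T := T) r u).toFinset

theorem mem_sphere [T.LocallyFinite] (hT : T.Connected) {r v : V} {n : ℕ} :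
    v ∈ sphere T r n ↔ T.dist r v = n := by
  induction n generalizing v with
  | zero => simp [sphere, hT.dist_eq_zero_iff, eq_comm]
  | succ n ih =>
    simp only [sphere, Finset.mem_biUnion, ih, Finite.mem_toFinset]
    constructor
    · rintro ⟨u, hu, -, hv⟩
      rw [hv, hu]
    · intro hv
      obtain ⟨u, hu, hu'⟩ := exists_adj_dist_succ hT (r := r) (v := v) (by rintro rfl; simp at hv)
      exact ⟨u, by omega, hu, hu'⟩

theorem card_sphere_succ [T.LocallyFinite] (hT : T.IsTree) {k : ℕ} (hk : T.IsRegularOfDegree k)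
    (r : V) (n : ℕ) : (sphere T r (n + 1)).card = k * (k - 1) ^ n := by
  classical
  have hstep : ∀ n, (sphere T r (n + 1)).card =
      ∑ u ∈ sphere T r n, (children T r u).ncard := by
    intro n
    rw [sphere, Finset.card_biUnion]
    · exact Finset.sum_congr rfl fun u _ => (Set.ncard_eq_toFinset_card _ _).symm
    · intro u _ u' _ hne
      rw [Function.onFun, Finset.disjoint_left]
      intro c h1 h2
      rw [Finite.mem_toFinset] at h1 h2
      exact hne (eq_of_adj_dist_succ hT h1.1 h2.1 h1.2 h2.2)
  induction n with
  | zero =>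
    rw [hstep]
    simp [sphere, ncard_children_root hk]
  | succ n ih =>
    rw [hstep, Finset.sum_congr rfl (g := fun _ => k - 1), Finset.sum_const, ih, smul_eq_mul,
      pow_succ, mul_assoc]
    intro u hu
    refine ncard_children_of_ne hT hk ?_
    rintro rfl
    rw [mem_sphere hT.connected] at hu
    simp at hu

theorem pow_le_card_sphere [T.LocallyFinite] (hT : T.IsTree) {k : ℕ} (hk : T.IsRegularOfDegree k)
    (r : V) (n : ℕ) : (k - 1) ^ n ≤ (sphere T r n).card := by
  cases n with
  | zero => simp [sphere]
  | succ n =>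
    rw [card_sphere_succ hT hk, pow_succ, mul_comm]
    gcongr
    omega

/-- Sums over a locally finite connected graph can be computed sphere by sphere. -/
theorem tsum_dist_eq [T.LocallyFinite] (hT : T.Connected) (r : V) (f : ℕ → ℝ≥0∞) :
    ∑' v, f (T.dist r v) = ∑' n, (sphere T r n).card * f n := by
  rw [← (Equiv.sigmaFiberEquiv (fun v => T.dist r v)).tsum_eq, ENNReal.tsum_sigma']
  refine tsum_congr fun n => ?_
  have h1 : ∀ v : {v // T.dist r v = n},
      f (T.dist r ((Equiv.sigmaFiberEquiv (fun v => T.dist r v)) ⟨n, v⟩)) = f n := by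
    intro v
    exact congrArg f v.2
  rw [tsum_congr h1]
  have e : {v // T.dist r v = n} ≃ sphere T r n :=
    Equiv.subtypeEquivRight fun v => (mem_sphere hT).symm
  rw [← e.symm.tsum_eq, tsum_fintype]
  simp

/-- Geodesics in a leafless tree can be prolonged. -/
theorem exists_dist_add [T.LocallyFinite] (hT : T.IsTree) {k : ℕ}
    (hk : T.IsRegularOfDegree k) (hk2 : 2 ≤ k) (r z : V) (n : ℕ) :
    ∃ y, T.dist z y = n ∧ T.dist r y = T.dist r z + n := by
  induction n with
  | zero => exact ⟨z, by simp⟩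
  | succ n ih =>
    obtain ⟨y, hy, hy'⟩ := ih
    obtain ⟨c, hc, hc'⟩ := children_nonempty hT hk hk2 r y
    refine ⟨c, ?_, by omega⟩
    have h1 := hT.connected.dist_triangle (u := z) (v := y) (w := c)
    have h2 := hT.connected.dist_triangle (u := r) (v := z) (w := c)
    rw [SimpleGraph.dist_eq_one_iff_adj.2 hc] at h1
    omega

/-- In a tree, geodesics that leave `m` through different neighbours can be concatenated. -/
theorem dist_add_of_disjoint_germs (hT : T.IsTree) {m a b : V}
    (h : ∀ c, T.Adj m c → T.dist m a = T.dist c a + 1 → T.dist m b ≠ T.dist c b + 1) :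
    T.dist a b = T.dist a m + T.dist m b := by
  induction hn : T.dist m b generalizing m with
  | zero =>
    rw [hT.connected.dist_eq_zero_iff] at hn
    simp [hn]
  | succ n ih =>
    have hmb : m ≠ b := by rintro rfl; simp at hn
    obtain ⟨c, hc, hc'⟩ := exists_adj_dist_succ hT.connected hmb
    rw [T.dist_comm (v := m), T.dist_comm (v := c)] at hc'
    have hca : T.dist a c = T.dist a m + 1 := by
      rcases hT.dist_eq_dist_add_one_of_adj a hc with h1 | h1
      · exact h1
      · refine absurd hc' (h c hc.symm ?_)
        rwa [T.dist_comm (v := a), T.dist_comm (v := a)]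
    -- The point `m` is moved one step towards `b`. At the new point `c` the only neighbour closer
    -- to `a` is `m`, which is farther from `b`, so the germs stay disjoint.
    have := ih (m := c) (fun d hd hda hdb => ?_) (by omega)
    · omega
    · rw [T.dist_comm (v := a), T.dist_comm (v := a)] at hda
      have hdm := eq_of_adj_dist_succ hT hd.symm hc.symm hda hca
      subst hdm
      omega

/-- Any three vertices of a tree have a median. -/
theorem exists_median (hT : T.IsTree) (a b c : V) :
    ∃ m, T.dist a b = T.dist a m + T.dist m b ∧ T.dist b c = T.dist b m + T.dist m c ∧
      T.dist c a = T.dist c m + T.dist m a := by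
  have : Nonempty V := ⟨a⟩
  -- The median minimises the sum of the three distances: a neighbour closer to two of the points
  -- would lower the sum by at least 1.
  obtain ⟨m, hm⟩ : ∃ m, ∀ x, T.dist m a + T.dist m b + T.dist m c ≤
      T.dist x a + T.dist x b + T.dist x c :=
    ⟨_, fun x => Function.argmin_le (fun m => T.dist m a + T.dist m b + T.dist m c) x⟩
  have hadj : ∀ x d, T.Adj m d → T.dist d x ≤ T.dist m x + 1 := by
    intro x d hd
    have := hT.connected.dist_triangle (u := d) (v := m) (w := x)
    rw [SimpleGraph.dist_eq_one_iff_adj.2 hd.symm] at this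
    omega
  refine ⟨m, ?_, ?_, ?_⟩ <;>
  · refine dist_add_of_disjoint_germs hT fun d hd h1 h2 => ?_
    have := hm d
    have := hadj a d hd
    have := hadj b d hd
    have := hadj c d hd
    omega

end Trees

/-! ### Regular trees of equal degree are isomorphic, with prescribed pairs of equidistant vertices.
-/

section TreeIsomorphism

variable {V V' : Type*} {T : SimpleGraph V} {T' : SimpleGraph V'}

variable (T) in
/-- The neighbour of `v` closer to the root `r` (and `r` itself for the root). -/
noncomputable def parent (r v : V) : V :=
  open Classical in if h : ∃ u, v ∈ children T r u then h.choose else r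

theorem mem_children_ne {r u c : V} (h : c ∈ children T r u) : c ≠ r := by
  rintro rfl
  have := h.2
  simp at this

theorem parent_eq (hT : T.IsTree) {r u c : V} (h : c ∈ children T r u) : parent T r c = u := by
  have hex : ∃ u, c ∈ children T r u := ⟨u, h⟩
  rw [parent, dif_pos hex]
  exact eq_of_adj_dist_succ hT hex.choose_spec.1 h.1 hex.choose_spec.2 h.2

theorem exists_mem_children (hT : T.Connected) {r v : V} (h : v ≠ r) :
    ∃ u, v ∈ children T r u :=
  exists_adj_dist_succ hT h

/-- Any vertex lies on the orbit of the root under a suitable selection of children. -/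
theorem exists_child_selection [T.LocallyFinite] (hT : T.IsTree) {k : ℕ}
    (hk : T.IsRegularOfDegree k) (hk2 : 2 ≤ k) (r y : V) :
    ∃ m : V → V, (∀ u, m u ∈ children T r u) ∧ m^[T.dist r y] r = y := by
  classical
  induction hn : T.dist r y generalizing y with
  | zero =>
    choose m hm using children_nonempty hT hk hk2 r
    rw [hT.connected.dist_eq_zero_iff] at hn
    exact ⟨m, hm, hn⟩
  | succ n ih =>
    obtain ⟨z, hz⟩ := exists_mem_children hT.connected (r := r) (v := y) (by rintro rfl; simp at hn)
    obtain ⟨m, hm, hmz⟩ := ih z (by have := hz.2; omega)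
    -- Redirecting the choice at the parent `z` of `y` leaves the orbit up to `z` unchanged, since
    -- its earlier points are closer to the root.
    refine ⟨Function.update m z y, fun u => ?_, ?_⟩
    · by_cases hu : u = z
      · subst hu
        simpa using hz
      · simpa [hu] using hm u
    · have hdist : ∀ j, T.dist r (m^[j] r) = j := by
        intro j
        induction j with
        | zero => simp
        | succ j ih =>
          rw [Function.iterate_succ_apply', (hm _).2, ih]
      have hagree : ∀ j ≤ n, (Function.update m z y)^[j] r = m^[j] r := by
        intro j hj
        induction j with
        | zero => rfl
        | succ j ih =>
          rw [Function.iterate_succ_apply', Function.iterate_succ_apply', ih (by omega),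
            Function.update_of_ne]
          intro h
          have h1 := hdist j
          rw [h] at h1
          have := hz.2
          omega
      rw [Function.iterate_succ_apply', hagree n le_rfl, hmz, Function.update_self]

/-- Any bijection is corrected by a transposition of the target. This lets the tree isomorphism
carry one selected child to another. -/
theorem exists_bijOn_map_eq {α β : Type*} {s : Set α} {t : Set β} (hs : s.Finite) (ht : t.Finite)
    (h : s.ncard = t.ncard) {a : α} {b : β} (ha : a ∈ s) (hb : b ∈ t) :
    ∃ f, BijOn f s t ∧ f a = b := by
  classical
  have : Nonempty β := ⟨b⟩
  obtain ⟨f, hf⟩ := hs.exists_bijOn_of_encard_eq (t := t)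
    (by rw [← hs.cast_ncard_eq, ← ht.cast_ncard_eq, h])
  refine ⟨Equiv.swap (f a) b ∘ f, BijOn.comp ?_ hf, by simp⟩
  exact Equiv.swap_bijOn_self (iff_of_true (hf.mapsTo ha) hb)

/-- The level-by-level extension of a family of maps between sets of children. -/
noncomputable def levelMap (T : SimpleGraph V) (r : V) (r' : V') (σ : V → V' → V → V') :
    ℕ → V → V'
  | 0, _ => r'
  | n + 1, v => σ (parent T r v) (levelMap T r r' σ n (parent T r v)) v

/-- Two regular trees of the same degree are isomorphic, by an isomorphism that takes a given pair
of vertices to a given pair of vertices at the same distance. -/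
theorem exists_iso_of_dist_eq [T.LocallyFinite] [T'.LocallyFinite] (hT : T.IsTree)
    (hT' : T'.IsTree) {k : ℕ} (hk : T.IsRegularOfDegree k) (hk' : T'.IsRegularOfDegree k)
    (hk2 : 2 ≤ k) {r y : V} {r' y' : V'} (hd : T.dist r y = T'.dist r' y') :
    ∃ e : T ≃g T', e r = r' ∧ e y = y' := by
  obtain ⟨m, hm, hmy⟩ := exists_child_selection hT hk hk2 r y
  obtain ⟨m', hm', hmy'⟩ := exists_child_selection hT' hk' hk2 r' y'
  -- The child counts match only when both vertices are roots or neither is; in the other case `f`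
  -- is an irrelevant constant. Selected children correspond, so the ray through `y` goes to the ray
  -- through `y'`.
  have hσ : ∀ u u', ∃ f : V → V', (u = r ↔ u' = r') →
      BijOn f (children T r u) (children T' r' u') ∧ f (m u) = m' u' := by
    intro u u'
    by_cases h : u = r ↔ u' = r'
    · obtain ⟨f, hf⟩ := exists_bijOn_map_eq (finite_children r u) (finite_children r' u')
        (by
          by_cases hu : u = r
          · rw [hu, h.1 hu, ncard_children_root hk, ncard_children_root hk']
          · rw [ncard_children_of_ne hT hk hu,
              ncard_children_of_ne hT' hk' fun hu' => hu (h.2 hu')]) (hm u) (hm' u')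
      exact ⟨f, fun _ => hf⟩
    · exact ⟨fun _ => r', fun h' => absurd h' h⟩
  choose σ hσ using hσ
  set Φ : V → V' := fun v => levelMap T r r' σ (T.dist r v) v with hΦ
  have hroot : Φ r = r' := by simp [hΦ, levelMap]
  have hchild : ∀ {u c}, c ∈ children T r u → Φ c = σ u (Φ u) c := by
    intro u c hc
    simp only [hΦ]
    rw [hc.2, levelMap, parent_eq hT hc]
  have hdist : ∀ n v, T.dist r v = n → T'.dist r' (Φ v) = n := by
    intro n
    induction n with
    | zero =>
      intro v hv
      rw [hT.connected.dist_eq_zero_iff] at hv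
      rw [← hv, hroot, SimpleGraph.dist_self]
    | succ n ih =>
      intro v hv
      obtain ⟨u, hu⟩ := exists_mem_children hT.connected (r := r) (v := v)
        (by rintro rfl; simp at hv)
      have hun : T.dist r u = n := by have := hu.2; omega
      have hiff : u = r ↔ Φ u = r' := by
        rw [eq_comm, ← hT.connected.dist_eq_zero_iff, hun, eq_comm (b := r'),
          ← hT'.connected.dist_eq_zero_iff, ih u hun]
      have := ((hσ u (Φ u) hiff).1.mapsTo hu).2
      rw [hchild hu, this, ih u hun]
  have hiff : ∀ u, u = r ↔ Φ u = r' := by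
    intro u
    rw [eq_comm, ← hT.connected.dist_eq_zero_iff, eq_comm (b := r'),
      ← hT'.connected.dist_eq_zero_iff, hdist _ u rfl]
  have hmaps : ∀ {u c}, c ∈ children T r u → Φ c ∈ children T' r' (Φ u) := by
    intro u c hc
    rw [hchild hc]
    exact (hσ u (Φ u) (hiff u)).1.mapsTo hc
  have hinj : ∀ n v w, T.dist r v = n → Φ v = Φ w → v = w := by
    intro n
    induction n with
    | zero =>
      intro v w hv h
      rw [hT.connected.dist_eq_zero_iff] at hv
      rw [← hv, hroot] at h
      rw [← hv, (hiff w).2 h.symm]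
    | succ n ih =>
      intro v w hv h
      have hvr : v ≠ r := by rintro rfl; simp at hv
      have hwr : w ≠ r := fun hw => hvr ((hiff v).2 (h.trans ((hiff w).1 hw)))
      obtain ⟨u, hu⟩ := exists_mem_children hT.connected hvr
      obtain ⟨x, hx⟩ := exists_mem_children hT.connected hwr
      have h1 := hmaps hu
      have h2 := hmaps hx
      rw [← h] at h2
      have hux := ih u x (by have := hu.2; omega) (eq_of_adj_dist_succ hT' h1.1 h2.1 h1.2 h2.2)
      subst hux
      rw [hchild hu, hchild hx] at h
      exact (hσ u (Φ u) (hiff u)).1.injOn hu hx h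
  have hsurj : ∀ n v', T'.dist r' v' = n → ∃ v, Φ v = v' := by
    intro n
    induction n with
    | zero =>
      intro v' hv'
      rw [hT'.connected.dist_eq_zero_iff] at hv'
      exact ⟨r, hroot.trans hv'⟩
    | succ n ih =>
      intro v' hv'
      obtain ⟨u', hu'⟩ := exists_mem_children hT'.connected (r := r') (v := v')
        (by rintro rfl; simp at hv')
      obtain ⟨u, rfl⟩ := ih u' (by have := hu'.2; omega)
      obtain ⟨c, hc, hc'⟩ := (hσ u (Φ u) (hiff u)).1.surjOn hu'
      exact ⟨c, (hchild hc).trans hc'⟩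
  have hback : ∀ {a b}, Φ b ∈ children T' r' (Φ a) → T.Adj a b := by
    intro a b h
    obtain ⟨u, hu⟩ := exists_mem_children hT.connected (r := r) (v := b)
      fun hb => mem_children_ne h ((hiff b).1 hb)
    have h1 := hmaps hu
    rw [hinj _ a u rfl (eq_of_adj_dist_succ hT' h.1 h1.1 h.2 h1.2)]
    exact hu.1
  have hadj : ∀ {a b}, T'.Adj (Φ a) (Φ b) ↔ T.Adj a b := by
    intro a b
    constructor
    · intro h
      rcases hT'.dist_eq_dist_add_one_of_adj r' h with h1 | h1
      · exact (hback ⟨h.symm, h1⟩).symm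
      · exact hback ⟨h, h1⟩
    · intro h
      rcases hT.dist_eq_dist_add_one_of_adj r h with h1 | h1
      · exact (hmaps ⟨h.symm, h1⟩).1.symm
      · exact (hmaps ⟨h, h1⟩).1
  have hiter : ∀ n, Φ (m^[n] r) = m'^[n] r' := by
    intro n
    induction n with
    | zero => exact hroot
    | succ n ih =>
      rw [Function.iterate_succ_apply', Function.iterate_succ_apply', hchild (hm _),
        (hσ _ _ (hiff _)).2, ih]
  refine ⟨⟨Equiv.ofBijective Φ ⟨fun v w h => hinj _ v w rfl h, fun v' => hsurj _ v' rfl⟩,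
    hadj⟩, hroot, ?_⟩
  change Φ y = y'
  rw [← hmy, hiter, hd, hmy']

end TreeIsomorphism

/-! ### Sums over products and trees, and automorphisms of the product. -/

/-- A finite set of tuples lies in the box spanned by its projections, over which the sum
factorises. -/
theorem tsum_pi_prod_le {ι : Type*} [Fintype ι] {V : ι → Type*} (f : ∀ i, V i → ℝ≥0∞) :
    ∑' x : ∀ i, V i, ∏ i, f i (x i) ≤ ∏ i, ∑' v, f i v := by
  classical
  rw [ENNReal.tsum_eq_iSup_sum]
  refine iSup_le fun s => ?_
  calc ∑ x ∈ s, ∏ i, f i (x i)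
      ≤ ∑ x ∈ Fintype.piFinset fun i => s.image fun x => x i, ∏ i, f i (x i) :=
        Finset.sum_le_sum_of_subset fun x hx => Fintype.mem_piFinset.2 fun i =>
          Finset.mem_image_of_mem (fun x => x i) hx
    _ = ∏ i, ∑ v ∈ s.image fun x => x i, f i v := (Finset.prod_univ_sum _ _).symm
    _ ≤ _ := Finset.prod_le_prod' fun i _ => ENNReal.sum_le_tsum _

/-- The sum of `(k - 1)^(-2 dist)` over a `k`-regular tree. -/
theorem tsum_inv_sq_pow_dist_le {V : Type*} {T : SimpleGraph V} [T.LocallyFinite]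
    (hT : T.IsTree) {k : ℕ} (hk : T.IsRegularOfDegree k) (hk3 : 3 ≤ k) (r : V) :
    ∑' v, ((((k - 1 : ℕ) : ℝ≥0∞)⁻¹) ^ 2) ^ T.dist r v ≤
      ENNReal.ofReal (((k : ℝ) - 1) / (√((k : ℝ) - 1) - 1) ^ 2) := by
  obtain ⟨q, rfl⟩ : ∃ q, k = q + 1 := ⟨k - 1, by omega⟩
  have hq : 2 ≤ q := by omega
  have hq0 : (q : ℝ≥0∞) ≠ 0 := by exact_mod_cast (by omega : q ≠ 0)
  have hqR : (2 : ℝ) ≤ q := by exact_mod_cast hq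
  rw [tsum_dist_eq hT.connected r (fun n => ((((q + 1 - 1 : ℕ) : ℝ≥0∞)⁻¹) ^ 2) ^ n),
    tsum_eq_zero_add' ENNReal.summable]
  simp only [card_sphere_succ hT hk, Nat.add_sub_cancel]
  set w : ℝ≥0∞ := (q : ℝ≥0∞)⁻¹ with hw
  have hqw : (q : ℝ≥0∞) * w = 1 := ENNReal.mul_inv_cancel hq0 (ENNReal.natCast_ne_top q)
  have hterm : ∀ n, (((q + 1) * q ^ n : ℕ) : ℝ≥0∞) * (w ^ 2) ^ (n + 1) =
      ((q + 1 : ℕ) : ℝ≥0∞) * w ^ 2 * w ^ n := by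
    intro n
    calc (((q + 1) * q ^ n : ℕ) : ℝ≥0∞) * (w ^ 2) ^ (n + 1)
        = ((q + 1 : ℕ) : ℝ≥0∞) * w ^ 2 * w ^ n * ((q : ℝ≥0∞) * w) ^ n := by
          push_cast
          ring
      _ = _ := by rw [hqw, one_pow, mul_one]
  simp_rw [hterm]
  rw [ENNReal.tsum_mul_left, ENNReal.tsum_geometric]
  have hwR : w = ENNReal.ofReal ((q : ℝ)⁻¹) := by
    rw [ENNReal.ofReal_inv_of_pos (by positivity), ENNReal.ofReal_natCast]
  have h1w : (1 - w)⁻¹ = ENNReal.ofReal ((1 - (q : ℝ)⁻¹)⁻¹) := by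
    have : 0 < 1 - (q : ℝ)⁻¹ := by
      rw [sub_pos]
      exact inv_lt_one_of_one_lt₀ (by linarith)
    rw [ENNReal.ofReal_inv_of_pos this, ENNReal.ofReal_sub _ (by positivity), ← hwR,
      ENNReal.ofReal_one]
  have hqc : ((q + 1 : ℕ) : ℝ≥0∞) = ENNReal.ofReal ((q : ℝ) + 1) := by
    rw [← ENNReal.ofReal_natCast]
    push_cast
    rfl
  have h1 : (0 : ℝ) < 1 - (q : ℝ)⁻¹ := by
    rw [sub_pos]
    exact inv_lt_one_of_one_lt₀ (by linarith)
  simp only [sphere, Finset.card_singleton, Nat.cast_one, pow_zero, mul_one]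
  rw [h1w, hqc, hwR, ← ENNReal.ofReal_pow (by positivity), ← ENNReal.ofReal_mul (by positivity),
    ← ENNReal.ofReal_mul (by positivity), ← ENNReal.ofReal_one,
    ← ENNReal.ofReal_add zero_le_one (by positivity)]
  refine ENNReal.ofReal_le_ofReal ?_
  push_cast
  rw [add_sub_cancel_right]
  set s := √(q : ℝ) with hs
  have hsq : s ^ 2 = q := Real.sq_sqrt (by positivity)
  have hs1 : 1 < s := by
    rw [hs, Real.lt_sqrt zero_le_one]
    linarith
  rw [← hsq]
  -- With s = √(k-1), this is the exact value of the sum: the root, plus a geometric series of ratio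
  -- 1/(k-1).
  have e1 : 1 + (s ^ 2 + 1) * (s ^ 2)⁻¹ ^ 2 * (1 - (s ^ 2)⁻¹)⁻¹ =
      (s ^ 4 + 1) / (s ^ 2 * (s ^ 2 - 1)) := by
    have h2 : s ^ 2 - 1 ≠ 0 := by nlinarith
    field_simp
    ring
  rw [e1, div_le_div_iff₀ (by nlinarith) (by nlinarith)]
  have h3 : 0 ≤ s ^ 2 * s ^ 2 * (s ^ 2 - 1) - (s ^ 4 + 1) * (s - 1) ^ 2 := by
    have : s ^ 2 * s ^ 2 * (s ^ 2 - 1) - (s ^ 4 + 1) * (s - 1) ^ 2 =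
        (s - 1) * (2 * s ^ 4 - s + 1) := by ring
    rw [this]
    have : s ≤ s ^ 4 := le_self_pow₀ hs1.le (by norm_num)
    refine mul_nonneg (by linarith) (by nlinarith)
  linarith

/-- Pairs of vertices at the same distances in every factor are related by an automorphism. -/
theorem exists_product_iso {ι : Type*} {V : ι → Type*} {T : ∀ i, SimpleGraph (V i)}
    [∀ i, (T i).LocallyFinite] {k : ι → ℕ} (hT : ∀ i, (T i).IsTree)
    (hreg : ∀ i, (T i).IsRegularOfDegree (k i))
    (hk : ∀ i, 3 ≤ k i) {x y x' y' : ∀ i, V i}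
    (h : ∀ i, (T i).dist (x i) (y i) = (T i).dist (x' i) (y' i)) :
    ∃ e : cartesianProduct T ≃g cartesianProduct T, e x = x' ∧ e y = y' := by
  choose e he using fun i => exists_iso_of_dist_eq (hT i) (hT i) (hreg i) (hreg i)
    (by have := hk i; omega) (h i)
  exact ⟨cartesianProductIso e, funext fun i => (he i).1, funext fun i => (he i).2⟩

/-! ### Decay of the two-point function and the triangle diagram. -/

section Product

variable {ι : Type*} [Fintype ι] {V : ι → Type*} {T : ∀ i, SimpleGraph (V i)}

theorem finite_neighborSet_cartesianProduct [∀ i, (T i).LocallyFinite] (v : ∀ i, V i) :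
    ((cartesianProduct T).neighborSet v).Finite := by
  classical
  refine (Set.finite_iUnion fun i => ((T i).neighborFinset (v i)).finite_toSet.image
    (Function.update v i)).subset ?_
  rintro w ⟨i, hi, hw⟩
  refine mem_iUnion.2 ⟨i, w i, by simpa using hi, ?_⟩
  ext j
  by_cases h : j = i
  · subst h
    simp
  · simp [h, hw j h]

/-- A product of locally finite connected graphs has an exhaustion by finite sets. -/
theorem exists_exhaustion [∀ i, (T i).LocallyFinite] (hT : ∀ i, (T i).Connected) (o : ∀ i, V i) :
    ∃ Λ : ℕ → Finset (∀ i, V i), Monotone Λ ∧ ∀ v, ∃ n, v ∈ Λ n := by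
  classical
  refine ⟨fun n => Fintype.piFinset fun i => (Finset.range (n + 1)).biUnion (sphere (T i) (o i)),
    fun m n hmn => ?_, fun v => ?_⟩
  · refine Fintype.piFinset_subset _ _ fun i => Finset.biUnion_subset_biUnion_of_subset_left _ ?_
    exact Finset.range_mono (by omega)
  · refine ⟨Finset.univ.sup fun i => (T i).dist (o i) (v i), Fintype.mem_piFinset.2 fun i => ?_⟩
    refine Finset.mem_biUnion.2 ⟨(T i).dist (o i) (v i), Finset.mem_range.2 ?_,
      (mem_sphere (hT i)).2 rfl⟩
    exact Nat.lt_succ_of_le (Finset.le_sup (f := fun i => (T i).dist (o i) (v i))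
      (Finset.mem_univ i))

variable [∀ i, (T i).LocallyFinite] {k : ι → ℕ}

/-- If the susceptibility is finite, then the two-point function is at most the product of the
inverse growth rates of the spheres. -/
theorem tau_le_prod_inv_pow_dist (hT : ∀ i, (T i).IsTree)
    (hreg : ∀ i, (T i).IsRegularOfDegree (k i)) (hk : ∀ i, 3 ≤ k i) {p : unitInterval} {C : ℝ≥0∞}
    (hC : C ≠ ⊤)
    (hsum : ∀ (L : Finset (∀ i, V i)) (u : ∀ i, V i), ∑ v ∈ L, tau (cartesianProduct T) p u v ≤ C)
    (o x : ∀ i, V i) :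
    tau (cartesianProduct T) p o x ≤
      ∏ i, (((k i - 1 : ℕ) : ℝ≥0∞)⁻¹) ^ (T i).dist (o i) (x i) := by
  classical
  set t := tau (cartesianProduct T) p o x with ht
  set d := fun i => (T i).dist (o i) (x i) with hd
  set A : ℕ := ∏ i, (k i - 1) ^ d i with hA
  obtain ⟨Λ, hmono, hex⟩ := exists_exhaustion (fun i => (hT i).connected) o
  have htau : ∀ {x y x' y' : ∀ i, V i}, (∀ i, (T i).dist (x i) (y i) = (T i).dist (x' i) (y' i)) →
      tau (cartesianProduct T) p x y = tau (cartesianProduct T) p x' y' := by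
    intro x y x' y' h
    obtain ⟨e, rfl, rfl⟩ := exists_product_iso hT hreg hk h
    exact (tau_map e p x y).symm
  -- Prolonging the geodesic by `d i` in each factor appends a pair with the same distance vector as
  -- (o, x), hence another factor `t`.
  have hpt : ∀ m : ℕ, ∃ z : ∀ i, V i, (∀ i, (T i).dist (o i) (z i) = m * d i) ∧
      t ^ m ≤ tau (cartesianProduct T) p o z := by
    intro m
    induction m with
    | zero =>
      refine ⟨o, fun i => by simp, ?_⟩
      simp [tau]
    | succ m ih =>
      obtain ⟨z, hz, hz'⟩ := ih
      choose y hy hy' using fun i => exists_dist_add (hT i) (hreg i)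
        (by have := hk i; omega) (o i) (z i) (d i)
      refine ⟨y, fun i => by rw [hy', hz, Nat.succ_mul], ?_⟩
      rw [pow_succ]
      refine le_trans (mul_le_mul' hz' (le_of_eq ?_)) (tau_mul_tau_le hmono hex p o z y)
      exact htau fun i => (hy i).symm
  -- The product of the spheres of radii `m * d i` has at least `A ^ m` vertices, all with the same
  -- two-point function, and their total is at most the susceptibility bound.
  have hpow : ∀ m : ℕ, ((A : ℝ≥0∞) * t) ^ m ≤ C := by
    intro m
    obtain ⟨z, hz, hz'⟩ := hpt m
    set L := Fintype.piFinset fun i => sphere (T i) (o i) (m * d i) with hL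
    have hcard : A ^ m ≤ L.card := by
      rw [hL, Fintype.card_piFinset, hA, ← Finset.prod_pow]
      refine Finset.prod_le_prod' fun i _ => ?_
      rw [← pow_mul, mul_comm]
      exact pow_le_card_sphere (hT i) (hreg i) _ _
    calc ((A : ℝ≥0∞) * t) ^ m = ((A ^ m : ℕ) : ℝ≥0∞) * t ^ m := by
          rw [mul_pow]
          push_cast
          rfl
      _ ≤ (L.card : ℝ≥0∞) * tau (cartesianProduct T) p o z := by gcongr
      _ = ∑ v ∈ L, tau (cartesianProduct T) p o v := by
          rw [← nsmul_eq_mul, ← Finset.sum_const]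
          refine Finset.sum_congr rfl fun v hv => htau fun i => ?_
          rw [hz, (mem_sphere (hT i).connected).1 (Fintype.mem_piFinset.1 hv i)]
      _ ≤ C := hsum L o
  have hle : (A : ℝ≥0∞) * t ≤ 1 := by
    by_contra! h
    have htop := ENNReal.tendsto_pow_atTop_nhds_top_iff.2 h
    have := htop.eventually (lt_mem_nhds (lt_top_iff_ne_top.2 hC))
    obtain ⟨m, hm⟩ := this.exists
    exact absurd hm (not_lt.2 (hpow m))
  have hA0 : (A : ℝ≥0∞) ≠ 0 := by
    have : 0 < A := Finset.prod_pos fun i _ => pow_pos (by have := hk i; omega) _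
    exact_mod_cast this.ne'
  have hAinv : ∏ i, (((k i - 1 : ℕ) : ℝ≥0∞)⁻¹) ^ d i = (A : ℝ≥0∞)⁻¹ := by
    rw [hA, Nat.cast_prod, ENNReal.prod_inv_distrib]
    · exact Finset.prod_congr rfl fun i _ => by rw [Nat.cast_pow, ENNReal.inv_pow]
    · intro i _ j _ _
      exact Or.inr (ENNReal.natCast_ne_top _)
  rw [hAinv]
  rw [mul_comm] at hle
  rwa [ENNReal.le_inv_iff_mul_le]

/-- At the critical probability, the two-point function is at most the product of the inverse
growth rates of the spheres. -/
theorem tau_criticalProbability_le (hT : ∀ i, (T i).IsTree)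
    (hreg : ∀ i, (T i).IsRegularOfDegree (k i)) (hk : ∀ i, 3 ≤ k i) (o x : ∀ i, V i) :
    tau (cartesianProduct T) (criticalProbability (cartesianProduct T)) o x ≤
      ∏ i, (((k i - 1 : ℕ) : ℝ≥0∞)⁻¹) ^ (T i).dist (o i) (x i) := by
  classical
  set G := cartesianProduct T
  set pc := criticalProbability G with hpc
  set D := ∏ i, (((k i - 1 : ℕ) : ℝ≥0∞)⁻¹) ^ (T i).dist (o i) (x i) with hD
  obtain ⟨Λ, hmono, hex⟩ := exists_exhaustion (fun i => (hT i).connected) o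
  have htrans : ∀ x y, ∃ e : G ≃g G, e x = y := by
    intro x y
    obtain ⟨e, he, -⟩ := exists_product_iso hT hreg hk (x := x) (y := x) (x' := y) (y' := y)
      (fun i => by simp)
    exact ⟨e, he⟩
  have hflux : ∀ {p : unitInterval} {S : Finset (∀ i, V i)}, o ∈ S → boundaryFlux G p S o < 1 →
      tau G p o x ≤ D := by
    intro p S hoS hS
    obtain ⟨C, hC, hsum⟩ := exists_sum_tau_le hmono hex htrans hoS hS
    exact tau_le_prod_inv_pow_dist hT hreg hk hC hsum o x
  -- If p_c = 0 there is nothing below it to approach from, but the factor p makes the flux at p_c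
  -- vanish.
  rcases (pc.2.1).eq_or_lt with h0 | h0
  · refine hflux (Finset.mem_singleton_self o) ?_
    simp [boundaryFlux, ← h0]
  have hDtop : D ≠ ⊤ := by
    refine ENNReal.prod_ne_top fun i _ => ENNReal.pow_ne_top (ENNReal.inv_ne_top.2 ?_)
    exact_mod_cast (by have := hk i; omega : k i - 1 ≠ 0)
  rw [tau_eq_iSup hmono hex]
  refine iSup_le fun n => ?_
  set A := connWithin G (Λ n : Set (∀ i, V i)) o x
  set f := coinPoly (edgeFinsetWithin (G := G) (Λ n)) A
  have hf : ∀ p : unitInterval, (bondMeasure G p).real A = f p := fun p =>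
    coinMeasure_real_eq_coinPoly p (determinedBy_connWithin_finset _ _ _)
  rw [← ENNReal.ofReal_toReal (measure_ne_top (bondMeasure G pc) A)]
  refine ENNReal.ofReal_le_of_le_toReal ?_
  change (bondMeasure G pc).real A ≤ _
  rw [hf]
  by_contra! hlt
  have hev := (continuous_coinPoly (edgeFinsetWithin (G := G) (Λ n)) A).tendsto (pc : ℝ)
    |>.eventually (lt_mem_nhds hlt)
  obtain ⟨ε, hε, hball⟩ := Metric.eventually_nhds_iff.1 hev
  -- A violation at p_c would persist by continuity on [a, p_c), which contains a parameter of flux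
  -- below 1. The term `pc / 2` keeps `a` positive.
  set a : ℝ := max (pc - ε / 2) (pc / 2) with ha
  have ha0 : 0 < a := lt_max_of_lt_right (by linarith)
  have hapc : a < pc := max_lt (by linarith) (by linarith)
  obtain ⟨p, hp, S, hoS, hS⟩ := exists_boundaryFlux_lt_one hmono hex
    finite_neighborSet_cartesianProduct o (a := ⟨a, ha0.le, hapc.le.trans pc.2.2⟩) ha0 hapc
  have hp1 : a ≤ p := hp.1
  have hp2 : (p : ℝ) < pc := hp.2
  have h1 : D.toReal < f p := hball (by
    rw [Real.dist_eq, abs_sub_lt_iff]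
    have := le_max_left ((pc : ℝ) - ε / 2) (pc / 2)
    constructor <;> linarith)
  rw [← hf] at h1
  refine absurd h1 (not_lt.2 (ENNReal.toReal_mono hDtop (le_trans ?_ (hflux hoS hS))))
  rw [tau_eq_iSup hmono hex]
  exact le_iSup (fun n => bondMeasure G p (connWithin G (Λ n : Set (∀ i, V i)) o x)) n

/-- A product of regular trees satisfies the triangle condition as soon as its two-point function
is bounded by the inverse growth rates of the spheres. -/
theorem triangle_le_of_tau_le (hT : ∀ i, (T i).IsTree)
    (hreg : ∀ i, (T i).IsRegularOfDegree (k i)) (hk : ∀ i, 3 ≤ k i) {p : unitInterval}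
    (htau : ∀ x y, tau (cartesianProduct T) p x y ≤
      ∏ i, (((k i - 1 : ℕ) : ℝ≥0∞)⁻¹) ^ (T i).dist (x i) (y i)) (o : ∀ i, V i) :
    triangle (cartesianProduct T) p o ≤
      (∏ i, ENNReal.ofReal (((k i : ℝ) - 1) / (√((k i : ℝ) - 1) - 1) ^ 2)) ^ 3 := by
  set w : ι → ℝ≥0∞ := fun i => ((k i - 1 : ℕ) : ℝ≥0∞)⁻¹ with hw
  set B := ∏ i, ENNReal.ofReal (((k i : ℝ) - 1) / (√((k i : ℝ) - 1) - 1) ^ 2) with hB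
  -- The square appears because each leg from the median is used by two of the three pairwise
  -- geodesics.
  set K : (∀ i, V i) → (∀ i, V i) → ℝ≥0∞ := fun x y => ∏ i, (w i ^ 2) ^ (T i).dist (x i) (y i)
    with hK
  have hKsum : ∀ m, ∑' x, K m x ≤ B := by
    intro m
    refine (tsum_pi_prod_le fun i v => (w i ^ 2) ^ (T i).dist (m i) v).trans ?_
    exact Finset.prod_le_prod' fun i _ => tsum_inv_sq_pow_dist_le (hT i) (hreg i) (hk i) (m i)
  have hterm : ∀ x y, tau (cartesianProduct T) p o x * tau (cartesianProduct T) p x y *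
      tau (cartesianProduct T) p y o ≤ ∑' m, K o m * (K m x * K m y) := by
    intro x y
    choose m h1 h2 h3 using fun i => exists_median (hT i) (o i) (x i) (y i)
    -- The median contributes one term of the sum over all `m`; enlarging to the whole sum decouples
    -- `m`, `x` and `y`.
    refine le_trans ?_ (ENNReal.le_tsum m)
    refine (mul_le_mul' (mul_le_mul' (htau o x) (htau x y)) (htau y o)).trans (le_of_eq ?_)
    simp only [hK, ← Finset.prod_mul_distrib]
    refine Finset.prod_congr rfl fun i _ => ?_
    rw [h1, h2, h3, (T i).dist_comm (u := x i) (v := m i), (T i).dist_comm (u := y i) (v := m i),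
      (T i).dist_comm (u := m i) (v := o i)]
    ring
  calc triangle (cartesianProduct T) p o
      ≤ ∑' x, ∑' y, ∑' m, K o m * (K m x * K m y) :=
        ENNReal.tsum_le_tsum fun x => ENNReal.tsum_le_tsum fun y => hterm x y
    _ = ∑' m, K o m * ((∑' x, K m x) * ∑' y, K m y) := by
        rw [tsum_congr fun x => ENNReal.tsum_comm, ENNReal.tsum_comm]
        refine tsum_congr fun m => ?_
        simp_rw [ENNReal.tsum_mul_left]
        rw [ENNReal.tsum_mul_right]
    _ ≤ ∑' m, K o m * (B * B) := by
        gcongr with m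
        · exact hKsum m
        · exact hKsum m
    _ = (∑' m, K o m) * (B * B) := ENNReal.tsum_mul_right
    _ ≤ B * (B * B) := by
        gcongr
        exact hKsum o
    _ = B ^ 3 := by ring

end Product

end Percolation

/-! ### The triangle condition. -/

theorem theorem1p2 {N : ℕ} {V : Fin N → Type*} (T : ∀ i, SimpleGraph (V i))
    [∀ i, (T i).LocallyFinite] (k : Fin N → ℕ) (hk : ∀ i, 3 ≤ k i)
    (hT : ∀ i, (T i).IsTree) (hreg : ∀ i, (T i).IsRegularOfDegree (k i))
    (o : ∀ i, V i) :
    Percolation.triangle (Percolation.cartesianProduct T)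
        (Percolation.criticalProbability (Percolation.cartesianProduct T)) o
      ≤ ENNReal.ofReal (∏ i, ((k i : ℝ) - 1) ^ 3 / (√((k i : ℝ) - 1) - 1) ^ 6) ∧
    Percolation.triangle (Percolation.cartesianProduct T)
        (Percolation.criticalProbability (Percolation.cartesianProduct T)) o < ⊤ := by
  have hnonneg : ∀ i, 0 ≤ ((k i : ℝ) - 1) / (√((k i : ℝ) - 1) - 1) ^ 2 := by
    intro i
    have : (3 : ℝ) ≤ k i := by exact_mod_cast hk i
    exact div_nonneg (by linarith) (by positivity)
  have h := Percolation.triangle_le_of_tau_le hT hreg hk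
    (Percolation.tau_criticalProbability_le hT hreg hk) o
  rw [← ENNReal.ofReal_prod_of_nonneg fun i _ => hnonneg i,
    ← ENNReal.ofReal_pow (Finset.prod_nonneg fun i _ => hnonneg i), ← Finset.prod_pow] at h
  have hle : Percolation.triangle (Percolation.cartesianProduct T)
      (Percolation.criticalProbability (Percolation.cartesianProduct T)) o
      ≤ ENNReal.ofReal (∏ i, ((k i : ℝ) - 1) ^ 3 / (√((k i : ℝ) - 1) - 1) ^ 6) := by
    refine h.trans (le_of_eq (congrArg _ (Finset.prod_congr rfl fun i _ => ?_)))
    rw [div_pow, ← pow_mul]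
  exact ⟨hle, hle.trans_lt ENNReal.ofReal_lt_top⟩
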